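/- Let $q,k\ge 1$ be integers, $\Theta\subset\mathbb R^q$ and $\theta_0\in\mathbb R^q$. For $\alpha\in\mathbb N^q$ write $|\alpha|=\sum_i\alpha^{(i)}$, $\theta^\alpha=\prod_i(\theta^{(i)})^{\alpha^{(i)}}$, let $D^\alpha$ be the corresponding partial derivative, and let $\mathcal I_n=\{\alpha\in\mathbb N^q:|\alpha|\le n\}$. Let $\mathcal E_j(\Theta)$ (resp. $\mathcal G_j(\Theta)$) be the set of probability distributions on $\Theta$ with exactly (resp. at most) $j$ atoms, and no other mass. For such a distribution $G=\sum_i p_i\delta_{\theta_i}$ put $G\phi=\sum_i p_i\phi(\theta_i)$, $G-\theta_0=\sum_i p_i\delta_{\theta_i-\theta_0}$, $m_\alpha(G)=\sum_i p_i\theta_i^\alpha$ and $\mathbf m_n(G)=(m_\alpha(G))_{\alpha\in\mathcal I_n}$. Let $W_\ell$ be the Wasserstein-$\ell$ distance with respect to the Euclidean norm. A family $\Phi$ of real functions on a neighbourhood of $\Theta$ *distinguishes* $\mathcal G_k(\Theta)$ if $\sup_{\phi\in\Phi}|G\phi-H\phi|>0$ for all $G\ne H$ in $\mathcal G_k(\Theta)$.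 It is an *$(m,k_0,k)$ linear independent domain* if every $\phi\in\Phi$ is $m$ times continuously differentiable on an open neighbourhood of $\Theta$ (the same for all $\phi$) and, for all integers $\ell\in[k_0,2k-k_0]$, all integers $m_1,\dots,m_\ell\in[1,m+1]$ with $\sum_i m_i\in[2k_0,2k]$, all distinct $\theta_1,\dots,\theta_\ell\in\Theta$ and all real coefficients $(a_{i\alpha})_{i\le \ell,\,|\alpha|\le m_i-1}$, $$\Big(\sum_{i=1}^{\ell}\sum_{|\alpha|\le m_i-1}a_{i\alpha}D^\alpha\phi(\theta_i)=0\ \text{ for all }\phi\in\Phi\quad\text{and}\quad\sum_{i=1}^{\ell}a_{i\mathbf 0}=0\Big)\iff a_{i\alpha}=0\ \text{ for all } i \text{ and all } |\alpha|\le m_i-1 .$$ **Lemma.** Let $\Phi_2=\{\theta\mapsto(\theta-\theta_0)^\alpha:\alpha\in\mathcal I_{2k-1}\}$. 1. $\Phi_2$ is a $(2k-1,1,k)$ linear independent domain. 2. $\Phi_2$ distinguishes $\mathcal G_k(\Theta)$. 3. If $\Theta$ is compact, then for every $k_0\in\{1,\dots,k\}$ and every $G_0\in\mathcal E_{k_0}(\Theta)$,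 with $d_1=k-k_0+1$, $$\liminf_{\substack{G,H\to G_0\text{ in }W_1\\ G\ne H\in\mathcal G_k(\Theta)}}\frac{\|\mathbf m_{2k-1}(G-\theta_0)-\mathbf m_{2k-1}(H-\theta_0)\|_\infty}{W_{2d_1-1}^{2d_1-1}(G,H)}>0 .$$ 4. If $\Theta$ is compact, then $$\inf_{G\ne H\in\mathcal G_k(\Theta)}\frac{\|\mathbf m_{2k-1}(G-\theta_0)-\mathbf m_{2k-1}(H-\theta_0)\|_\infty}{W_{2k-1}^{2k-1}(G,H)}>0 .$$ Here the infimum and the lower limit over an empty set of pairs are $+\infty$. -/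

import Mathlib

open Filter Topology Convexity

noncomputable section

namespace FiniteMixture

/-- The ambient Euclidean space `ℝ^q`, with the Euclidean norm. -/
abbrev Space (q : ℕ) : Type := EuclideanSpace ℝ (Fin q)

/-- The index set of all multi-indices `α ∈ ℕ^q` with `|α| = ∑ i, α i ≤ n`. -/
def multiIndices (q n : ℕ) : Finset (Fin q → ℕ) :=
  (Fintype.piFinset fun _ : Fin q => Finset.range (n + 1)).filter fun α => ∑ i, α i ≤ n

/-- The entries are automatically at most `n`, so that the bounding box is no restriction. -/
theorem mem_multiIndices {q n : ℕ} {α : Fin q → ℕ} :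
    α ∈ multiIndices q n ↔ ∑ i, α i ≤ n := by
  simp only [multiIndices, Finset.mem_filter, Fintype.mem_piFinset, Finset.mem_range,
    and_iff_right_iff_imp]
  intro h i
  have := Finset.single_le_sum (f := α) (fun j _ => Nat.zero_le _) (Finset.mem_univ i)
  omega

/-- `θ ^ α = ∏ i, (θ i) ^ (α i)`. -/
def monomial {q : ℕ} (α : Fin q → ℕ) (θ : Space q) : ℝ := ∏ i, θ i ^ α i

/-- The partial derivative in the `i`-th coordinate. -/
def partialD {q : ℕ} (i : Fin q) (f : Space q → ℝ) : Space q → ℝ :=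
  fun θ => fderiv ℝ f θ (EuclideanSpace.single i 1)

/-- `D^α`: partial derivative of order `α i` in the `i`-th coordinate, for every `i`. -/
def multiD {q : ℕ} (α : Fin q → ℕ) (f : Space q → ℝ) : Space q → ℝ :=
  (List.finRange q).foldr (fun i g => (partialD i)^[α i] g) f

/-- Probability distributions with finitely many atoms in `ℝ^q`: `∑ p_i δ_{θ_i}` is stored as the
finitely supported function sending each atom `θ_i` to its mass `p_i > 0` and every other point
to `0`. Two of them are equal exactly if they are equal as measures. -/
abbrev DiscreteProb (q : ℕ) : Type := StdSimplex ℝ (Space q)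

/-- `ℰ_k(Θ)`: distributions with exactly `k` distinct atoms, all of them in `Θ`. -/
def exactAtoms {q : ℕ} (k : ℕ) (Θ : Set (Space q)) : Set (DiscreteProb q) :=
  {G | (G.weights.support : Set (Space q)) ⊆ Θ ∧ G.weights.support.card = k}

/-- `𝒢_k(Θ)`: distributions with at most `k` distinct atoms, all of them in `Θ`. -/
def atMostAtoms {q : ℕ} (k : ℕ) (Θ : Set (Space q)) : Set (DiscreteProb q) :=
  {G | (G.weights.support : Set (Space q)) ⊆ Θ ∧ G.weights.support.card ≤ k}

/-- `G φ = ∫ φ dG = ∑ p_i φ(θ_i)`. -/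
def expect {q : ℕ} (G : DiscreteProb q) (φ : Space q → ℝ) : ℝ :=
  ∑ θ ∈ G.weights.support, G.weights θ * φ θ

/-- `G - θ₀`: all atoms are shifted by `-θ₀`. -/
def shift {q : ℕ} (G : DiscreteProb q) (θ₀ : Space q) : DiscreteProb q :=
  G.map fun θ => θ - θ₀

/-- The vector of the moments `m_α(G) = ∫ θ^α dG`, `|α| ≤ n`. As a function on a finite type it
carries the sup norm. -/
def momentVec {q : ℕ} (n : ℕ) (G : DiscreteProb q) : multiIndices q n → ℝ :=
  fun α => expect G (monomial (α : Fin q → ℕ))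

/-- `c` is a joint distribution on (atoms of `G`) × (atoms of `H`) with marginals `G` and `H`. -/
def IsCoupling {q : ℕ} (G H : DiscreteProb q) (c : Space q → Space q → ℝ) : Prop :=
  (∀ θ ∈ G.weights.support, ∀ η ∈ H.weights.support, 0 ≤ c θ η) ∧
  (∀ θ ∈ G.weights.support, ∑ η ∈ H.weights.support, c θ η = G.weights θ) ∧
  (∀ η ∈ H.weights.support, ∑ θ ∈ G.weights.support, c θ η = H.weights η)

/-- The Wasserstein distance `W_p` with respect to the Euclidean distance. -/
def wasserstein {q : ℕ} (p : ℕ) (G H : DiscreteProb q) : ℝ :=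
  (sInf {t : ℝ | ∃ c : Space q → Space q → ℝ, IsCoupling G H c ∧
    t = ∑ θ ∈ G.weights.support, ∑ η ∈ H.weights.support, c θ η * ‖θ - η‖ ^ p}) ^ ((p : ℝ)⁻¹)

/-- The filter of convergence `G → G₀` under `W_1`. -/
def w1Nhds {q : ℕ} (G₀ : DiscreteProb q) : Filter (DiscreteProb q) :=
  comap (fun G => wasserstein 1 G G₀) (𝓝 0)

/-- The filter of `G, H → G₀` under `W_1` with `G ≠ H ∈ 𝒢_k(Θ)`. -/
def pairsNear {q : ℕ} (k : ℕ) (Θ : Set (Space q)) (G₀ : DiscreteProb q) :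
    Filter (DiscreteProb q × DiscreteProb q) :=
  (w1Nhds G₀ ×ˢ w1Nhds G₀) ⊓
    𝓟 {P | P.1 ∈ atMostAtoms k Θ ∧ P.2 ∈ atMostAtoms k Θ ∧ P.1 ≠ P.2}

/-- `𝒢_k(Θ)` is distinguishable by `Φ`. The supremum is taken in the extended reals. -/
def IsDistinguishable {q : ℕ} (k : ℕ) (Θ : Set (Space q)) (Φ : Set (Space q → ℝ)) : Prop :=
  ∀ G ∈ atMostAtoms k Θ, ∀ H ∈ atMostAtoms k Θ, G ≠ H →
    0 < ⨆ φ ∈ Φ, ((|expect G φ - expect H φ| : ℝ) : EReal)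

/-- `(m, k₀, k)` linear independent domains. Differentiability on `Θ` means that there is a
neighbourhood of `Θ` on which every member of `Φ` is `m` times continuously differentiable. -/
def IsLinearIndependentDomain {q : ℕ} (m k₀ k : ℕ) (Θ : Set (Space q))
    (Φ : Set (Space q → ℝ)) : Prop :=
  (∃ U : Set (Space q), IsOpen U ∧ Θ ⊆ U ∧ ∀ φ ∈ Φ, ContDiffOn ℝ m φ U) ∧
  ∀ ℓ : ℕ, k₀ ≤ ℓ → ℓ + k₀ ≤ 2 * k →
  ∀ M : Fin ℓ → ℕ, (∀ i, 1 ≤ M i ∧ M i ≤ m + 1) →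
    2 * k₀ ≤ ∑ i, M i → ∑ i, M i ≤ 2 * k →
  ∀ θ : Fin ℓ → Space q, Function.Injective θ → (∀ i, θ i ∈ Θ) →
  ∀ a : Fin ℓ → (Fin q → ℕ) → ℝ,
    ((∀ φ ∈ Φ, ∑ i, ∑ α ∈ multiIndices q (M i - 1), a i α * multiD α φ (θ i) = 0) ∧
        ∑ i, a i 0 = 0) ↔
      ∀ i, ∀ α ∈ multiIndices q (M i - 1), a i α = 0

/-- The monomials `θ ↦ (θ - θ₀)^α` with `|α| ≤ n`. -/
def monomialFamily {q : ℕ} (n : ℕ) (θ₀ : Space q) : Set (Space q → ℝ) :=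
  {φ | ∃ α ∈ multiIndices q n, φ = fun θ => monomial α (θ - θ₀)}

end FiniteMixture

end

open FiniteMixture

noncomputable section

namespace FiniteMixture

open scoped ContDiff

/-! Claims 2, 3 and 4 rest on one estimate in one dimension. Let `δ` be the distance of the moment
vectors, and let `u` be a vector of bounded norm whose inner products with the differences of the
atoms of `G` and `H` are comparable to the lengths of these differences
(`exists_separating_direction`). By the multinomial theorem `δ` controls `G P - H P` for every
polynomial `P` of degree at most `2k - 1` in the coordinate `⟨u, θ - θ₀⟩`, up to the size of its
coefficients. There are at most `2k` atoms in all, so `P` can agree on them with the indicator of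
`(-∞, t]`. If no atom projects into `(t, t + ℓ)` and at most `e + 1` atoms are close together, the
coefficients are of order `ℓ⁻ᵉ` (`exists_interpolation`). Hence the distribution functions at `t`
differ by at most a constant times `δ ℓ⁻ᵉ`. The monotone coupling moves at most this much mass
between two atoms on either side of `t`, and `t` can be taken at a gap of length comparable to their
distance. This gives `W_e^e ≤ C δ` (`exists_wasserstein_pow_le`).

With `e = 2k - 1` the clustering condition is void, which yields claims 2 and 4. Near `G₀` each
distribution keeps an atom close to each of the `k₀` atoms of `G₀`, so a cluster holds at most `2d₁`
atoms and `e = 2d₁ - 1` suffices for claim 3.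

For claim 1 the relation is tested on `P(⟨u, θ - θ₀⟩)`. Where the projected points are distinct,
Hermite interpolation gives `∑_{|α| = m} a_{iα} u^α = 0`. This holds off finitely many hyperplanes
in `u`, so all coefficients vanish. -/

/-! ### Interpolation of a step function with controlled coefficients -/

/-- Every partial sum of the absolute values of the coefficients of `P` is at most `b`. -/
def CoeffSumLE (P : Polynomial ℝ) (b : ℝ) : Prop :=
  ∀ N : ℕ, ∑ j ∈ Finset.range N, |P.coeff j| ≤ b

theorem CoeffSumLE.mono {P : Polynomial ℝ} {b c : ℝ} (h : CoeffSumLE P b) (hbc : b ≤ c) :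
    CoeffSumLE P c := fun N => (h N).trans hbc

theorem CoeffSumLE.add {P Q : Polynomial ℝ} {b c : ℝ} (hP : CoeffSumLE P b)
    (hQ : CoeffSumLE Q c) : CoeffSumLE (P + Q) (b + c) := by
  intro N
  calc ∑ j ∈ Finset.range N, |(P + Q).coeff j|
      ≤ ∑ j ∈ Finset.range N, (|P.coeff j| + |Q.coeff j|) :=
        Finset.sum_le_sum fun j _ => by rw [Polynomial.coeff_add]; exact abs_add_le _ _
    _ ≤ b + c := by rw [Finset.sum_add_distrib]; exact add_le_add (hP N) (hQ N)

theorem CoeffSumLE.C_mul {P : Polynomial ℝ} {b : ℝ} (hP : CoeffSumLE P b) (r : ℝ) :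
    CoeffSumLE (Polynomial.C r * P) (|r| * b) := by
  intro N
  simp only [Polynomial.coeff_C_mul, abs_mul, ← Finset.mul_sum]
  exact mul_le_mul_of_nonneg_left (hP N) (abs_nonneg r)

theorem CoeffSumLE.X_mul {P : Polynomial ℝ} {b : ℝ} (hP : CoeffSumLE P b) :
    CoeffSumLE (Polynomial.X * P) b := by
  intro N
  cases N with
  | zero => simpa using hP 0
  | succ N =>
    rw [Finset.sum_range_succ']
    simpa [Polynomial.coeff_X_mul] using hP N

theorem CoeffSumLE.one : CoeffSumLE 1 1 := by
  intro N
  simp only [Polynomial.coeff_one]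
  rw [Finset.sum_congr rfl (g := fun j => if j = 0 then (1 : ℝ) else 0)
    (fun j _ => by split_ifs <;> simp), Finset.sum_ite_eq']
  split_ifs <;> norm_num

theorem CoeffSumLE.zero : CoeffSumLE 0 0 := by
  intro N; simp

/-- Aitken–Neville interpolation of the indicator of `(-∞, t]` on a finite set without points in
`(t, t + ℓ)`. The coefficients are of order `ℓ⁻ᵉ` if at most `e + 1` points are close together. -/
theorem exists_interpolation {R ρ ℓ t A : ℝ} {e : ℕ} (hR : 0 ≤ R) (hℓ : 0 < ℓ)
    (hℓ1 : ℓ ≤ 1) (hA1 : 1 ≤ A) (hAR : 2 * (1 + R) ≤ A) (hAρ : 2 * (1 + R) ≤ A * ρ) :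
    ∀ (n : ℕ) (S : Finset ℝ), S.card = n → (∀ x ∈ S, |x| ≤ R) →
      (∀ x ∈ S, ∀ y ∈ S, x ≤ t → t < y → ℓ ≤ y - x) →
      (∀ T ⊆ S, (∀ x ∈ T, ∀ y ∈ T, y - x < ρ) → T.card ≤ e + 1) →
      ∃ P : Polynomial ℝ, P.natDegree ≤ n - 1 ∧
        (∀ x ∈ S, P.eval x = if x ≤ t then 1 else 0) ∧
        CoeffSumLE P (A ^ n * (ℓ⁻¹) ^ min (n - 1) e) := by
  have hℓ' : 1 ≤ ℓ⁻¹ := (one_le_inv₀ hℓ).2 hℓ1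
  intro n
  induction n with
  | zero =>
    intro S hS _ _ _
    rw [Finset.card_eq_zero] at hS
    exact ⟨0, by simp, by simp [hS], CoeffSumLE.zero.mono (by positivity)⟩
  | succ n ih =>
    intro S hS hSR hgap hclus
    have hA0 : 0 ≤ A := by linarith
    have hbase : 1 ≤ A ^ (n + 1) * (ℓ⁻¹) ^ min (n + 1 - 1) e :=
      one_le_mul_of_one_le_of_one_le (one_le_pow₀ hA1) (one_le_pow₀ hℓ')
    by_cases h1 : ∀ x ∈ S, x ≤ t
    · exact ⟨1, by simp, fun x hx => by simp [h1 x hx], CoeffSumLE.one.mono hbase⟩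
    by_cases h2 : ∀ x ∈ S, t < x
    · exact ⟨0, by simp, fun x hx => by simp [h2 x hx],
        CoeffSumLE.zero.mono (by linarith)⟩
    push Not at h1 h2
    obtain ⟨y, hyS, hy⟩ := h1
    obtain ⟨x, hxS, hx⟩ := h2
    have hne : S.Nonempty := ⟨x, hxS⟩
    set a := S.min' hne with ha
    set b := S.max' hne with hb
    have haS : a ∈ S := S.min'_mem hne
    have hbS : b ∈ S := S.max'_mem hne
    have hat : a ≤ t := (S.min'_le x hxS).trans hx
    have htb : t < b := hy.trans_le (S.le_max' y hyS)
    have hab : ℓ ≤ b - a := hgap a haS b hbS hat htb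
    have hab0 : 0 < b - a := hℓ.trans_le hab
    have hn : 1 ≤ n := by
      have : 1 < S.card := Finset.one_lt_card.2 ⟨a, haS, b, hbS, by linarith⟩
      omega
    have sub : ∀ c ∈ S, ∃ P : Polynomial ℝ, P.natDegree ≤ n - 1 ∧
        (∀ x ∈ S.erase c, P.eval x = if x ≤ t then 1 else 0) ∧
        CoeffSumLE P (A ^ n * (ℓ⁻¹) ^ min (n - 1) e) := by
      intro c hc
      refine ih (S.erase c) (by rw [Finset.card_erase_of_mem hc, hS]; rfl) ?_ ?_ ?_
      · exact fun x hx => hSR x (Finset.mem_of_mem_erase hx)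
      · exact fun x hx y hy => hgap x (Finset.mem_of_mem_erase hx) y (Finset.mem_of_mem_erase hy)
      · exact fun T hT => hclus T (hT.trans (Finset.erase_subset _ _))
    obtain ⟨P, hPd, hPe, hPn⟩ := sub a haS
    obtain ⟨Q, hQd, hQe, hQn⟩ := sub b hbS
    set B := A ^ n * (ℓ⁻¹) ^ min (n - 1) e with hB
    have hB0 : 0 ≤ B := by positivity
    -- Neville's formula `((X - a) P + (b - X) Q) / (b - a)`, where `P` interpolates off the minimum
    -- `a` and `Q` off the maximum `b`.
    refine ⟨Polynomial.C (b - a)⁻¹ * ((Polynomial.X * P + Polynomial.C (-a) * P) +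
      (Polynomial.C b * Q + Polynomial.C (-1) * (Polynomial.X * Q))), ?_, ?_, ?_⟩
    · have e1 : ∀ c : ℝ, ∀ P : Polynomial ℝ, P.natDegree ≤ n - 1 →
          (Polynomial.C c * P).natDegree ≤ n := fun c P h =>
        (Polynomial.natDegree_C_mul_le _ _).trans (h.trans (by omega))
      have e2 : ∀ P : Polynomial ℝ, P.natDegree ≤ n - 1 →
          (Polynomial.X * P).natDegree ≤ n := fun P h => by
        refine Polynomial.natDegree_mul_le.trans ?_
        rw [Polynomial.natDegree_X]; omega
      refine (Polynomial.natDegree_C_mul_le _ _).trans ?_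
      rw [Nat.add_sub_cancel]
      refine Polynomial.natDegree_add_le_of_degree_le
        (Polynomial.natDegree_add_le_of_degree_le (e2 P hPd) (e1 _ P hPd))
        (Polynomial.natDegree_add_le_of_degree_le (e1 _ Q hQd)
          ((Polynomial.natDegree_C_mul_le _ _).trans (e2 Q hQd)))
    · intro z hz
      have hne' : b - a ≠ 0 := hab0.ne'
      simp only [Polynomial.eval_mul, Polynomial.eval_add, Polynomial.eval_C, Polynomial.eval_X]
      rw [inv_mul_eq_iff_eq_mul₀ hne']
      by_cases hza : z = a
      · rw [hza, hQe a (Finset.mem_erase.2 ⟨by linarith, haS⟩)]; ring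
      by_cases hzb : z = b
      · rw [hzb, hPe b (Finset.mem_erase.2 ⟨by linarith, hbS⟩)]; ring
      rw [hPe z (Finset.mem_erase.2 ⟨hza, hz⟩), hQe z (Finset.mem_erase.2 ⟨hzb, hz⟩)]; ring
    · refine (((hPn.X_mul.add (hPn.C_mul (-a))).add
        ((hQn.C_mul b).add (hQn.X_mul.C_mul (-1)))).C_mul (b - a)⁻¹).mono ?_
      have haR := hSR a haS
      have hbR := hSR b hbS
      rw [abs_of_pos (inv_pos.2 hab0), abs_neg, abs_neg, abs_one]
      have step : (b - a)⁻¹ * (B + |a| * B + (|b| * B + 1 * B)) ≤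
          (b - a)⁻¹ * (2 * (1 + R)) * B := by
        rw [mul_assoc]
        refine mul_le_mul_of_nonneg_left ?_ (inv_pos.2 hab0).le
        nlinarith
      refine step.trans ?_
      -- A wide set costs only the factor `A`. A set narrower than `ρ` costs `A * ℓ⁻¹`, but then it
      -- is a single cluster, so `n ≤ e` and the exponent `min n e` has room for one more power.
      by_cases hd : ρ ≤ b - a
      · have : (b - a)⁻¹ * (2 * (1 + R)) ≤ A := by
          rw [inv_mul_le_iff₀ hab0]; nlinarith
        calc (b - a)⁻¹ * (2 * (1 + R)) * B ≤ A * B := mul_le_mul_of_nonneg_right this hB0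
          _ = A ^ (n + 1) * (ℓ⁻¹) ^ min (n - 1) e := by rw [hB]; ring
          _ ≤ _ := by
            refine mul_le_mul_of_nonneg_left (pow_le_pow_right₀ hℓ' ?_) (by positivity)
            omega
      · have hc : S.card ≤ e + 1 := by
          refine hclus S subset_rfl fun x hx y hy => ?_
          have := S.min'_le x hx
          have := S.le_max' y hy
          rw [← ha] at *
          rw [← hb] at *
          linarith
        have : (b - a)⁻¹ * (2 * (1 + R)) ≤ A * ℓ⁻¹ := by
          rw [mul_comm A]
          exact mul_le_mul (inv_anti₀ hℓ hab) hAR (by positivity) (by positivity)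
        calc (b - a)⁻¹ * (2 * (1 + R)) * B ≤ A * ℓ⁻¹ * B := mul_le_mul_of_nonneg_right this hB0
          _ = A ^ (n + 1) * (ℓ⁻¹) ^ (min (n - 1) e + 1) := by rw [hB]; ring
          _ = _ := by congr 2; omega

/-! ### Directions that separate finitely many vectors -/

/-- Finitely many vectors admit a linear functional that is quantitatively nonzero on all of
them. -/
theorem exists_separating_direction {E : Type*} [NormedAddCommGroup E] [InnerProductSpace ℝ E]
    (M : ℕ) : ∃ c : ℝ, 0 < c ∧ c ≤ 1 ∧ ∀ T : Finset E, T.card ≤ M →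
      ∃ u : E, ‖u‖ ≤ M ∧ ∀ v ∈ T, c * ‖v‖ ≤ |inner ℝ u v| := by
  classical
  induction M with
  | zero =>
    refine ⟨1, one_pos, le_rfl, fun T hT => ⟨0, by simp, ?_⟩⟩
    have : T = ∅ := by simpa using hT
    simp [this]
  | succ M ih =>
    obtain ⟨c, hc, hc1, h⟩ := ih
    refine ⟨c / 4, by linarith, by linarith, fun T hT => ?_⟩
    rcases T.eq_empty_or_nonempty with rfl | ⟨v, hv⟩
    · exact ⟨0, by simp; positivity, by simp⟩
    obtain ⟨u, hu, hT'⟩ := h (T.erase v) (by rw [Finset.card_erase_of_mem hv]; omega)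
    by_cases hvu : c / 4 * ‖v‖ ≤ |inner ℝ u v|
    · refine ⟨u, hu.trans (by push_cast; linarith), fun x hx => ?_⟩
      by_cases hxv : x = v
      · rw [hxv]; exact hvu
      · have := hT' x (Finset.mem_erase.2 ⟨hxv, hx⟩)
        nlinarith [norm_nonneg x]
    · push Not at hvu
      have hv0 : v ≠ 0 := by rintro rfl; simp at hvu
      have hvn : 0 < ‖v‖ := norm_pos_iff.2 hv0
      set w := ‖v‖⁻¹ • v with hw
      have hwn : ‖w‖ = 1 := by rw [hw, norm_smul, norm_inv, norm_norm, inv_mul_cancel₀ hvn.ne']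
      have hwv : inner ℝ w v = ‖v‖ := by
        rw [hw, real_inner_smul_left, real_inner_self_eq_norm_sq]; field_simp
      -- At `v` the correction contributes `c / 2` against a defect below `c / 4`; at the other
      -- vectors it takes at most `c / 2` out of `c`. Both leave at least `c / 4`.
      refine ⟨u + (c / 2) • w, ?_, fun x hx => ?_⟩
      · refine (norm_add_le _ _).trans ?_
        rw [norm_smul, hwn, Real.norm_of_nonneg (by linarith)]
        push_cast; linarith
      · rw [inner_add_left, real_inner_smul_left]
        by_cases hxv : x = v
        · rw [hxv, hwv]
          have := neg_abs_le (inner ℝ u v)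
          refine le_trans ?_ (le_abs_self _)
          nlinarith
        · have h1 := hT' x (Finset.mem_erase.2 ⟨hxv, hx⟩)
          have h2 : |inner ℝ w x| ≤ ‖x‖ := by
            simpa [hwn] using abs_real_inner_le_norm w x
          have h3 : |(c / 2) * inner ℝ w x| ≤ c / 2 * ‖x‖ := by
            rw [abs_mul, abs_of_pos (by linarith : (0:ℝ) < c / 2)]
            exact mul_le_mul_of_nonneg_left h2 (by linarith)
          have h4 := abs_sub_abs_le_abs_sub (inner ℝ u x) (-((c / 2) * inner ℝ w x))
          rw [abs_neg, sub_neg_eq_add] at h4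
          nlinarith [norm_nonneg x]

/-! ### Moments along a direction -/

theorem expect_shift {q : ℕ} (G : DiscreteProb q) (θ₀ : Space q) (φ : Space q → ℝ) :
    expect (shift G θ₀) φ = expect G fun θ => φ (θ - θ₀) := by
  have h := Finsupp.sum_mapDomain_index (f := fun θ : Space q => θ - θ₀) (s := G.weights)
    (h := fun θ r => r * φ θ) (by simp) (by intros; ring)
  exact h

theorem expect_sum {q : ℕ} {ι : Type*} (G : DiscreteProb q) (s : Finset ι) (c : ι → ℝ)
    (φ : ι → Space q → ℝ) :
    expect G (fun θ => ∑ i ∈ s, c i * φ i θ) = ∑ i ∈ s, c i * expect G (φ i) := by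
  simp only [expect, Finset.mul_sum]
  rw [Finset.sum_comm]
  exact Finset.sum_congr rfl fun i _ => Finset.sum_congr rfl fun θ _ => by ring

theorem abs_expect_monomial_sub_le {q n : ℕ} (G H : DiscreteProb q) (θ₀ : Space q)
    {α : Fin q → ℕ} (hα : α ∈ multiIndices q n) :
    |expect G (fun θ => monomial α (θ - θ₀)) - expect H (fun θ => monomial α (θ - θ₀))| ≤
      ‖momentVec n (shift G θ₀) - momentVec n (shift H θ₀)‖ := by
  have := norm_le_pi_norm (momentVec n (shift G θ₀) - momentVec n (shift H θ₀)) ⟨α, hα⟩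
  simpa [momentVec, expect_shift] using this

theorem inner_pow_eq_sum {q : ℕ} (u v : Space q) (j : ℕ) :
    (inner ℝ u v) ^ j = ∑ α ∈ Finset.piAntidiag Finset.univ j,
      ((Nat.multinomial Finset.univ α : ℝ) * monomial α u) * monomial α v := by
  have : inner ℝ u v = ∑ i, u i * v i := by
    rw [PiLp.inner_apply]
    exact Finset.sum_congr rfl fun i _ => by simp [mul_comm]
  rw [this, Finset.sum_pow_eq_sum_piAntidiag]
  refine Finset.sum_congr rfl fun α _ => ?_
  simp only [mul_pow, Finset.prod_mul_distrib, monomial]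
  ring

/-- The multinomial theorem is used twice: to expand the power into monomials, and to reassemble the
absolute values of the coefficients into `(∑ |u i|) ^ j`. -/
theorem abs_expect_inner_pow_sub_le {q n j : ℕ} (hj : j ≤ n) (G H : DiscreteProb q)
    (θ₀ u : Space q) :
    |expect G (fun θ => (inner ℝ u (θ - θ₀)) ^ j) - expect H (fun θ => (inner ℝ u (θ - θ₀)) ^ j)| ≤
      (∑ i, |u i|) ^ j * ‖momentVec n (shift G θ₀) - momentVec n (shift H θ₀)‖ := by
  simp only [inner_pow_eq_sum, expect_sum]
  rw [← Finset.sum_sub_distrib, Finset.sum_pow_eq_sum_piAntidiag, Finset.sum_mul]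
  refine (Finset.abs_sum_le_sum_abs _ _).trans (Finset.sum_le_sum fun α hα => ?_)
  rw [← mul_sub, abs_mul, abs_mul, Nat.abs_cast]
  have h1 : |monomial α u| = ∏ i, |u i| ^ α i := by
    simp only [monomial, Finset.abs_prod, abs_pow]
  rw [h1]
  refine mul_le_mul_of_nonneg_left (abs_expect_monomial_sub_le G H θ₀ ?_) ?_
  · rw [mem_multiIndices]
    rw [Finset.mem_piAntidiag] at hα
    exact hα.1.le.trans hj
  · exact mul_nonneg (Nat.cast_nonneg _) (Finset.prod_nonneg fun i _ => by positivity)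

theorem abs_expect_polynomial_sub_le {q n : ℕ} (G H : DiscreteProb q) (θ₀ u : Space q)
    {P : Polynomial ℝ} (hP : P.natDegree ≤ n) {b K : ℝ} (hb : CoeffSumLE P b) (hK : 1 ≤ K)
    (hu : ∑ i, |u i| ≤ K) :
    |expect G (fun θ => P.eval (inner ℝ u (θ - θ₀))) -
      expect H (fun θ => P.eval (inner ℝ u (θ - θ₀)))| ≤
      b * K ^ n * ‖momentVec n (shift G θ₀) - momentVec n (shift H θ₀)‖ := by
  set δ := ‖momentVec n (shift G θ₀) - momentVec n (shift H θ₀)‖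
  simp only [Polynomial.eval_eq_sum_range, expect_sum]
  rw [← Finset.sum_sub_distrib]
  calc _ ≤ ∑ j ∈ Finset.range (P.natDegree + 1), |P.coeff j| * (K ^ n * δ) := by
        refine (Finset.abs_sum_le_sum_abs _ _).trans (Finset.sum_le_sum fun j hj => ?_)
        rw [← mul_sub, abs_mul]
        refine mul_le_mul_of_nonneg_left ?_ (abs_nonneg _)
        have hjn : j ≤ n := by rw [Finset.mem_range] at hj; omega
        refine (abs_expect_inner_pow_sub_le hjn G H θ₀ u).trans ?_
        refine mul_le_mul_of_nonneg_right ?_ (norm_nonneg _)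
        exact (pow_le_pow_left₀ (Finset.sum_nonneg fun i _ => abs_nonneg _) hu j).trans
          (pow_le_pow_right₀ hK hjn)
    _ ≤ b * K ^ n * δ := by
        rw [← Finset.sum_mul, mul_assoc]
        exact mul_le_mul_of_nonneg_right (hb _) (by positivity)

/-! ### Distribution functions along a coordinate and overlaps of intervals -/

section Monotone

variable {ι : Type*} (A : Finset ι) (g : ι → ℝ) (x : ι → ℝ)

/-- The mass that `g` gives to the points `θ ∈ A` with `x θ ≤ t`. -/
def massLE (t : ℝ) : ℝ := ∑ θ ∈ A with x θ ≤ t, g θ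

/-- The mass that `g` gives to the points `θ ∈ A` with `x θ < t`. -/
def massLT (t : ℝ) : ℝ := ∑ θ ∈ A with x θ < t, g θ

variable {A g x}

theorem massLE_mono (hg : ∀ θ ∈ A, 0 ≤ g θ) {s t : ℝ} (h : s ≤ t) :
    massLE A g x s ≤ massLE A g x t := by
  refine Finset.sum_le_sum_of_subset_of_nonneg ?_ fun i hi _ => hg i (Finset.mem_filter.1 hi).1
  exact Finset.monotone_filter_right A fun _ _ hx => le_trans hx h

theorem massLT_le_massLE (hg : ∀ θ ∈ A, 0 ≤ g θ) (t : ℝ) :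
    massLT A g x t ≤ massLE A g x t := by
  refine Finset.sum_le_sum_of_subset_of_nonneg ?_ fun i hi _ => hg i (Finset.mem_filter.1 hi).1
  exact Finset.monotone_filter_right A fun _ _ hx => le_of_lt hx

theorem massLE_le_massLT (hg : ∀ θ ∈ A, 0 ≤ g θ) {s t : ℝ} (h : s < t) :
    massLE A g x s ≤ massLT A g x t := by
  refine Finset.sum_le_sum_of_subset_of_nonneg ?_ fun i hi _ => hg i (Finset.mem_filter.1 hi).1
  exact Finset.monotone_filter_right A fun _ _ hx => lt_of_le_of_lt hx h

theorem massLT_nonneg (hg : ∀ θ ∈ A, 0 ≤ g θ) (t : ℝ) : 0 ≤ massLT A g x t :=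
  Finset.sum_nonneg fun i hi => hg i (Finset.mem_filter.1 hi).1

theorem massLE_le_sum (hg : ∀ θ ∈ A, 0 ≤ g θ) (t : ℝ) : massLE A g x t ≤ ∑ θ ∈ A, g θ :=
  Finset.sum_le_sum_of_subset_of_nonneg (Finset.filter_subset _ _) fun i hi _ => hg i hi

theorem massLE_eq_massLT_add (hx : Set.InjOn x A) {θ : ι} (hθ : θ ∈ A) :
    massLE A g x (x θ) = massLT A g x (x θ) + g θ := by
  classical
  have : A.filter (fun η => x η ≤ x θ) = insert θ (A.filter fun η => x η < x θ) := by
    ext η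
    simp only [Finset.mem_filter, Finset.mem_insert]
    constructor
    · rintro ⟨h1, h2⟩
      rcases h2.lt_or_eq with h | h
      · exact Or.inr ⟨h1, h⟩
      · exact Or.inl (hx h1 hθ h)
    · rintro (rfl | ⟨h1, h2⟩)
      · exact ⟨hθ, le_rfl⟩
      · exact ⟨h1, h2.le⟩
  rw [massLE, massLT, this, Finset.sum_insert (by simp), add_comm]

/-- The sum telescopes: in the order of `x`, the mass strictly below an atom is the mass up to and
including its predecessor. -/
theorem sum_massLE_sub_massLT (hx : Set.InjOn x A) (f : ℝ → ℝ) :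
    ∑ θ ∈ A, (f (massLE A g x (x θ)) - f (massLT A g x (x θ))) =
      f (∑ θ ∈ A, g θ) - f 0 := by
  classical
  induction A using Finset.induction_on_max_value x with
  | empty => simp
  | insert a s ha hmax ih =>
    have hlt : ∀ θ ∈ s, x θ < x a := fun θ hθ =>
      (hmax θ hθ).lt_of_ne fun h => ha (hx (by simp) (by simp [hθ]) h.symm ▸ hθ)
    have hs : ∀ θ ∈ s, massLE (insert a s) g x (x θ) = massLE s g x (x θ) ∧
        massLT (insert a s) g x (x θ) = massLT s g x (x θ) := by
      intro θ hθ
      have := hlt θ hθ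
      simp only [massLE, massLT, Finset.filter_insert, not_le.2 this, not_lt.2 this.le, if_false,
        and_self]
    have h1 : massLT (insert a s) g x (x a) = ∑ θ ∈ s, g θ := by
      rw [massLT, Finset.filter_insert, if_neg (lt_irrefl _), Finset.filter_true_of_mem hlt]
    have hs' : ∀ θ ∈ s, f (massLE (insert a s) g x (x θ)) - f (massLT (insert a s) g x (x θ)) =
        f (massLE s g x (x θ)) - f (massLT s g x (x θ)) := fun θ hθ => by
      rw [(hs θ hθ).1, (hs θ hθ).2]
    rw [Finset.sum_insert ha, massLE_eq_massLT_add hx (by simp), h1,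
      Finset.sum_congr rfl hs', ih (hx.mono (by simp)), Finset.sum_insert ha, add_comm (g a)]
    ring

end Monotone

/-- The length of `[a, b] ∩ [c, d]`. -/
def overlap (a b c d : ℝ) : ℝ := max 0 (min b d - max a c)

/-- As a difference of increments of `min b` and `min a`, the overlap can be summed by telescoping.
-/
theorem overlap_eq {a b c d : ℝ} (hab : a ≤ b) (hcd : c ≤ d) :
    overlap a b c d = (min b d - min b c) - (min a d - min a c) := by
  unfold overlap
  grind

theorem overlap_comm (a b c d : ℝ) : overlap a b c d = overlap c d a b := by
  rw [overlap, overlap, min_comm, max_comm a c]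

/-- The intervals `[massLT, massLE]` of the atoms tile `[0, ∑ h]`, so their overlaps with `[a, b]`
add up to its length. -/
theorem sum_overlap {ι : Type*} {B : Finset ι} {h x : ι → ℝ} (hh : ∀ η ∈ B, 0 ≤ h η)
    (hx : Set.InjOn x B) {a b : ℝ} (ha : 0 ≤ a) (hab : a ≤ b) (hb : b ≤ ∑ η ∈ B, h η) :
    ∑ η ∈ B, overlap a b (massLT B h x (x η)) (massLE B h x (x η)) = b - a := by
  rw [Finset.sum_congr rfl fun η _ => overlap_eq hab (massLT_le_massLE hh (x η)),
    Finset.sum_sub_distrib, sum_massLE_sub_massLT hx (fun t => min b t),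
    sum_massLE_sub_massLT hx (fun t => min a t)]
  rw [min_eq_left hb, min_eq_left (hab.trans hb), min_eq_right ha, min_eq_right (ha.trans hab)]
  ring

/-- A finite set of reals with at most `N` elements leaves a gap of relative length `1 / (N + 1)`
in every interval. -/
theorem exists_gap {S : Finset ℝ} {N : ℕ} (hS : S.card ≤ N) {a b : ℝ} (hab : a < b) :
    ∃ t ℓ : ℝ, 0 < ℓ ∧ a ≤ t ∧ t + ℓ ≤ b ∧ b - a = (N + 1) * ℓ ∧
      ∀ s ∈ S, t < s → t + ℓ < s := by
  have hN : (0 : ℝ) < N + 1 := by positivity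
  set ℓ := (b - a) / (N + 1) with hℓ
  have hℓ0 : 0 < ℓ := div_pos (sub_pos.2 hab) hN
  have hba : b - a = (N + 1) * ℓ := by rw [hℓ]; field_simp
  by_contra hcon
  push Not at hcon
  -- Without a gap each of the `N + 1` disjoint cells `(a + jℓ, a + (j + 1)ℓ]` contains a point of
  -- `S`, contradicting the pigeonhole principle.
  have key : ∀ j : Fin (N + 1), ∃ s ∈ S, a + j * ℓ < s ∧ s ≤ a + j * ℓ + ℓ := by
    intro j
    have hj : ((j : ℕ) : ℝ) ≤ N := by exact_mod_cast Nat.lt_succ_iff.1 j.2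
    exact hcon (a + j * ℓ) ℓ hℓ0 (by nlinarith [Nat.cast_nonneg (α := ℝ) (j : ℕ)])
      (by nlinarith) hba
  choose s hsS hs1 hs2 using key
  have hinj : Function.Injective s := by
    intro i j hij
    by_contra hne
    wlog hlt : (i : ℕ) < j generalizing i j
    · exact this hij.symm (Ne.symm hne) (by have := Fin.val_ne_of_ne hne; omega)
    have : ((i : ℕ) : ℝ) + 1 ≤ (j : ℕ) := by exact_mod_cast hlt
    have h1 := hs2 i
    have h2 := hs1 j
    rw [hij] at h1
    nlinarith
  have := Finset.card_le_card_of_injOn s (s := Finset.univ) (t := S) (fun i _ => hsS i)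
    hinj.injOn
  simp at this
  omega

/-! ### Wasserstein distances of finitely supported distributions -/

theorem sum_weights {q : ℕ} (G : DiscreteProb q) : ∑ θ ∈ G.weights.support, G.weights θ = 1 :=
  G.total

theorem wasserstein_pow {q p : ℕ} (hp : p ≠ 0) (G H : DiscreteProb q) :
    wasserstein p G H ^ p = sInf {t : ℝ | ∃ c : Space q → Space q → ℝ, IsCoupling G H c ∧
      t = ∑ θ ∈ G.weights.support, ∑ η ∈ H.weights.support, c θ η * ‖θ - η‖ ^ p} := by
  refine Real.rpow_inv_natCast_pow (Real.sInf_nonneg ?_) hp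
  rintro t ⟨c, hc, rfl⟩
  exact Finset.sum_nonneg fun θ hθ => Finset.sum_nonneg fun η hη =>
    mul_nonneg (hc.1 θ hθ η hη) (by positivity)

theorem wasserstein_pow_le_of_isCoupling {q p : ℕ} (hp : p ≠ 0) {G H : DiscreteProb q}
    {c : Space q → Space q → ℝ} (hc : IsCoupling G H c) :
    wasserstein p G H ^ p ≤
      ∑ θ ∈ G.weights.support, ∑ η ∈ H.weights.support, c θ η * ‖θ - η‖ ^ p := by
  rw [wasserstein_pow hp]
  refine csInf_le ⟨0, ?_⟩ ⟨c, hc, rfl⟩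
  rintro t ⟨c, hc, rfl⟩
  exact Finset.sum_nonneg fun θ hθ => Finset.sum_nonneg fun η hη =>
    mul_nonneg (hc.1 θ hθ η hη) (by positivity)

theorem isCoupling_mul {q : ℕ} (G H : DiscreteProb q) :
    IsCoupling G H fun θ η => G.weights θ * H.weights η := by
  refine ⟨fun θ _ η _ => mul_nonneg (G.nonneg θ) (H.nonneg η), fun θ _ => ?_, fun η _ => ?_⟩
  · rw [← Finset.mul_sum, sum_weights, mul_one]
  · rw [← Finset.sum_mul, sum_weights, one_mul]

/-- If every `η` in the support of `H` except possibly `θ` has distance at least `r` from the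
atom `θ` of `G`, the surplus mass at `θ` has to travel at least `r`. -/
theorem mul_pow_le_wasserstein_pow {q p : ℕ} (hp : p ≠ 0) {G H : DiscreteProb q} {θ : Space q}
    (hθ : θ ∈ G.weights.support) {r : ℝ} (hr : 0 ≤ r)
    (hH : ∀ η ∈ H.weights.support, η ≠ θ → r ≤ ‖θ - η‖) :
    (G.weights θ - H.weights θ) * r ^ p ≤ wasserstein p G H ^ p := by
  classical
  rw [wasserstein_pow hp]
  refine le_csInf ⟨_, _, isCoupling_mul G H, rfl⟩ ?_
  rintro t ⟨c, hc, rfl⟩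
  have hnn : ∀ θ ∈ G.weights.support, ∀ η ∈ H.weights.support, 0 ≤ c θ η * ‖θ - η‖ ^ p :=
    fun θ hθ η hη => mul_nonneg (hc.1 θ hθ η hη) (by positivity)
  refine le_trans ?_ (Finset.single_le_sum (f := fun θ => ∑ η ∈ H.weights.support,
    c θ η * ‖θ - η‖ ^ p) (fun θ hθ => Finset.sum_nonneg (hnn θ hθ)) hθ)
  have hsum := hc.2.1 θ hθ
  have hdiag : ∑ η ∈ H.weights.support with η = θ, c θ η ≤ H.weights θ := by
    by_cases hθH : θ ∈ H.weights.support
    · rw [Finset.filter_eq' , if_pos hθH, Finset.sum_singleton, ← hc.2.2 θ hθH]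
      exact Finset.single_le_sum (f := fun x => c x θ) (fun x hx => hc.1 x hx θ hθH) hθ
    · rw [Finset.filter_eq', if_neg hθH, Finset.sum_empty]
      exact H.nonneg θ
  rw [← Finset.sum_filter_add_sum_filter_not _ (fun η => η = θ)] at hsum
  calc (G.weights θ - H.weights θ) * r ^ p
      ≤ (∑ η ∈ H.weights.support with ¬ η = θ, c θ η) * r ^ p :=
        mul_le_mul_of_nonneg_right (by linarith) (by positivity)
    _ ≤ ∑ η ∈ H.weights.support with ¬ η = θ, c θ η * ‖θ - η‖ ^ p := by
        rw [Finset.sum_mul]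
        refine Finset.sum_le_sum fun η hη => ?_
        rw [Finset.mem_filter] at hη
        exact mul_le_mul_of_nonneg_left (pow_le_pow_left₀ hr (hH η hη.1 hη.2) p)
          (hc.1 θ hθ η hη.1)
    _ ≤ _ := Finset.sum_le_sum_of_subset_of_nonneg (Finset.filter_subset _ _)
        fun η hη _ => hnn θ hθ η hη

theorem exists_weights_lt {q : ℕ} {G H : DiscreteProb q} (hGH : G ≠ H) :
    ∃ θ, H.weights θ < G.weights θ := by
  classical
  by_contra hcon
  push Not at hcon
  have hsub : G.weights.support ⊆ H.weights.support := fun θ hθ => by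
    rw [Finsupp.mem_support_iff] at hθ ⊢
    exact (((G.nonneg θ).lt_of_ne (Ne.symm hθ)).trans_le (hcon θ)).ne'
  have hG : ∑ θ ∈ H.weights.support, G.weights θ = 1 := by
    rw [← sum_weights G]
    exact (Finset.sum_subset hsub fun θ _ h => Finsupp.notMem_support_iff.1 h).symm
  have heq := (Finset.sum_eq_sum_iff_of_le fun θ _ => hcon θ).1 (hG.trans (sum_weights H).symm)
  apply hGH
  ext θ
  by_cases h : θ ∈ H.weights.support
  · exact heq θ h
  · rw [Finsupp.notMem_support_iff.1 h, Finsupp.notMem_support_iff.1 fun h' => h (hsub h')]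

/-- Some atom of `G` has more mass than `H` puts there, and the surplus has to travel a positive
distance because the support of `H` is finite. -/
theorem wasserstein_pow_pos {q p : ℕ} (hp : p ≠ 0) {G H : DiscreteProb q} (hGH : G ≠ H) :
    0 < wasserstein p G H ^ p := by
  classical
  obtain ⟨θ, hθ⟩ := exists_weights_lt hGH
  have hθG : θ ∈ G.weights.support := by
    rw [Finsupp.mem_support_iff]
    exact ((H.nonneg θ).trans_lt hθ).ne'
  obtain ⟨r, hr, hr'⟩ : ∃ r : ℝ, 0 < r ∧ ∀ η ∈ H.weights.support.erase θ, r ≤ ‖θ - η‖ := by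
    rcases (H.weights.support.erase θ).eq_empty_or_nonempty with h | h
    · exact ⟨1, one_pos, by simp [h]⟩
    · obtain ⟨η, hη, hmin⟩ := Finset.exists_min_image _ (fun η => ‖θ - η‖) h
      refine ⟨‖θ - η‖, norm_pos_iff.2 (sub_ne_zero.2 (Finset.ne_of_mem_erase hη).symm), hmin⟩
  refine lt_of_lt_of_le (mul_pos (sub_pos.2 hθ) (pow_pos hr p))
    (mul_pow_le_wasserstein_pow hp hθG hr.le fun η hη hne => hr' η ?_)
  exact Finset.mem_erase.2 ⟨hne, hη⟩

/-! ### The monotone coupling and the main estimate -/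

/-- The coupling that is monotone with respect to the coordinate `x`. -/
theorem exists_monotone_coupling {q : ℕ} (G H : DiscreteProb q) (x : Space q → ℝ)
    (hG : Set.InjOn x G.weights.support) (hH : Set.InjOn x H.weights.support) :
    ∃ c : Space q → Space q → ℝ, IsCoupling G H c ∧
      ∀ θ η t, (x θ ≤ t ∧ t < x η ∨ x η ≤ t ∧ t < x θ) →
        c θ η ≤ |massLE G.weights.support G.weights x t -
          massLE H.weights.support H.weights x t| := by
  have hGn : ∀ θ ∈ G.weights.support, 0 ≤ G.weights θ := fun θ _ => G.nonneg θ
  have hHn : ∀ θ ∈ H.weights.support, 0 ≤ H.weights θ := fun θ _ => H.nonneg θ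
  -- The quantile coupling: each atom occupies an interval of `[0, 1]` as long as its mass, and two
  -- atoms share the length of the overlap.
  refine ⟨fun θ η => overlap (massLT G.weights.support G.weights x (x θ))
    (massLE G.weights.support G.weights x (x θ)) (massLT H.weights.support H.weights x (x η))
    (massLE H.weights.support H.weights x (x η)), ⟨fun θ _ η _ => le_max_left _ _, ?_, ?_⟩, ?_⟩
  · intro θ hθ
    rw [sum_overlap hHn hH (massLT_nonneg hGn _) (massLT_le_massLE hGn _),
      massLE_eq_massLT_add hG hθ, add_sub_cancel_left]
    rw [sum_weights, ← sum_weights G]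
    exact massLE_le_sum hGn _
  · intro η hη
    simp only [overlap_comm (massLT G.weights.support G.weights x _)]
    rw [sum_overlap hGn hG (massLT_nonneg hHn _) (massLT_le_massLE hHn _),
      massLE_eq_massLT_add hH hη, add_sub_cancel_left]
    rw [sum_weights, ← sum_weights H]
    exact massLE_le_sum hHn _
  -- The interval of the atom on the left of `t` ends no later than its distribution function at
  -- `t`, and the interval of the other atom starts no earlier than the other distribution function
  -- at `t`.
  · rintro θ η t (⟨h1, h2⟩ | ⟨h1, h2⟩)
    · have e1 := massLE_mono (x := x) hGn h1
      have e2 := massLE_le_massLT (x := x) hHn h2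
      refine max_le (abs_nonneg _) (le_trans ?_ (le_abs_self _))
      exact sub_le_sub ((min_le_left _ _).trans e1) (e2.trans (le_max_right _ _))
    · have e1 := massLE_mono (x := x) hHn h1
      have e2 := massLE_le_massLT (x := x) hGn h2
      refine max_le (abs_nonneg _) (le_trans ?_ (neg_le_abs _))
      rw [neg_sub]
      exact sub_le_sub ((min_le_right _ _).trans e1) (e2.trans (le_max_left _ _))

theorem sum_abs_le_mul_norm {q : ℕ} (u : Space q) : ∑ i, |u i| ≤ q * ‖u‖ := by
  calc ∑ i, |u i| ≤ ∑ _i : Fin q, ‖u‖ :=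
        Finset.sum_le_sum fun i _ => by simpa using PiLp.norm_apply_le u i
    _ = q * ‖u‖ := by simp

open Classical in
/-- The distribution functions of `G` and `H` along a direction differ by little at a gap of length
`ℓ` between the atoms, if at most `e + 1` atoms are close together in this direction. -/
theorem exists_abs_massLE_sub_mul_pow_le (q k e : ℕ) {R ρ K : ℝ} (hR : 0 ≤ R)
    (hρ : 0 < ρ) (hK : 0 ≤ K) :
    ∃ C : ℝ, 0 < C ∧ ∀ (θ₀ : Space q) (G H : DiscreteProb q),
      G.weights.support.card ≤ k → H.weights.support.card ≤ k →
      (∀ θ ∈ G.weights.support ∪ H.weights.support, ‖θ - θ₀‖ ≤ R) →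
      ∀ u : Space q, ‖u‖ ≤ K →
      (∀ T ⊆ G.weights.support ∪ H.weights.support,
        (∀ θ ∈ T, ∀ η ∈ T, inner ℝ u (η - θ) < ρ) → T.card ≤ e + 1) →
      ∀ t ℓ : ℝ, 0 < ℓ → ℓ ≤ 1 →
      (∀ θ ∈ G.weights.support ∪ H.weights.support, t < inner ℝ u (θ - θ₀) →
        t + ℓ ≤ inner ℝ u (θ - θ₀)) →
      |massLE G.weights.support G.weights (fun θ => inner ℝ u (θ - θ₀)) t -
        massLE H.weights.support H.weights (fun θ => inner ℝ u (θ - θ₀)) t| * ℓ ^ e ≤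
        C * ‖momentVec (2 * k - 1) (shift G θ₀) - momentVec (2 * k - 1) (shift H θ₀)‖ := by
  set R' := K * R with hR'
  have hR0 : 0 ≤ R' := by positivity
  set A := max 1 (max (2 * (1 + R')) (2 * (1 + R') / ρ)) with hA
  have hA1 : 1 ≤ A := le_max_left _ _
  have hA2 : 2 * (1 + R') ≤ A := (le_max_left _ _).trans (le_max_right _ _)
  have hA3 : 2 * (1 + R') ≤ A * ρ := by
    rw [← div_le_iff₀ hρ]; exact (le_max_right _ _).trans (le_max_right _ _)
  set K' := max 1 (q * K) with hK'
  have hK1 : 1 ≤ K' := le_max_left _ _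
  refine ⟨A ^ (2 * k) * K' ^ (2 * k - 1), by positivity, ?_⟩
  intro θ₀ G H hGk hHk hS u hu hclus t ℓ hℓ hℓ1 hgap
  set S := G.weights.support ∪ H.weights.support with hSdef
  set x : Space q → ℝ := fun θ => inner ℝ u (θ - θ₀) with hx
  have hxsub : ∀ θ η, inner ℝ u (η - θ) = x η - x θ := fun θ η => by
    rw [hx, ← inner_sub_right, sub_sub_sub_cancel_right]
  have hScard : (S.image x).card ≤ 2 * k :=
    Finset.card_image_le.trans ((Finset.card_union_le _ _).trans (by omega))
  obtain ⟨P, hPd, hPe, hPn⟩ := exists_interpolation (e := e) (t := t) hR0 hℓ hℓ1 hA1 hA2 hA3 _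
    (S.image x) rfl
    (by
      intro y hy
      obtain ⟨θ, hθ, rfl⟩ := Finset.mem_image.1 hy
      exact (abs_real_inner_le_norm _ _).trans
        (mul_le_mul hu (hS θ hθ) (norm_nonneg _) hK))
    (by
      intro y _ z hz hyt htz
      obtain ⟨θ, hθ, rfl⟩ := Finset.mem_image.1 hz
      linarith [hgap θ hθ htz])
    (by
      intro T hT hTρ
      -- Clusters of projected values lift to clusters of atoms, which are at least as numerous.
      have : T = (S.filter fun θ => x θ ∈ T).image x := by
        ext y
        simp only [Finset.mem_image, Finset.mem_filter]
        constructor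
        · intro hy
          obtain ⟨θ, hθ, rfl⟩ := Finset.mem_image.1 (hT hy)
          exact ⟨θ, ⟨hθ, hy⟩, rfl⟩
        · rintro ⟨θ, ⟨_, h⟩, rfl⟩
          exact h
      rw [this]
      refine Finset.card_image_le.trans (hclus _ (Finset.filter_subset _ _) fun θ hθ η hη => ?_)
      rw [hxsub]
      exact hTρ _ (Finset.mem_filter.1 hθ).2 _ (Finset.mem_filter.1 hη).2)
  -- On the atoms `P` is the indicator of `x ≤ t`, so its expectation is the distribution function
  -- at `t`.
  have hexp : ∀ F : DiscreteProb q, F.weights.support ⊆ S →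
      expect F (fun θ => P.eval (x θ)) = massLE F.weights.support F.weights x t := by
    intro F hF
    rw [expect, massLE, Finset.sum_filter]
    refine Finset.sum_congr rfl fun θ hθ => ?_
    rw [hPe _ (Finset.mem_image_of_mem x (hF hθ))]
    split_ifs <;> simp
  have hu' : ∑ i, |u i| ≤ K' :=
    (sum_abs_le_mul_norm u).trans ((mul_le_mul_of_nonneg_left hu (Nat.cast_nonneg q)).trans
      (le_max_right _ _))
  have hmain := abs_expect_polynomial_sub_le G H θ₀ u (hPd.trans (Nat.sub_le_sub_right hScard 1))
    hPn hK1 hu'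
  change |expect G (fun θ => P.eval (x θ)) - expect H (fun θ => P.eval (x θ))| ≤ _ at hmain
  rw [hexp G Finset.subset_union_left, hexp H Finset.subset_union_right] at hmain
  set δ := ‖momentVec (2 * k - 1) (shift G θ₀) - momentVec (2 * k - 1) (shift H θ₀)‖
  have hδ : 0 ≤ δ := norm_nonneg _
  have hinv : 1 ≤ ℓ⁻¹ := (one_le_inv₀ hℓ).2 hℓ1
  have hb : A ^ (S.image x).card * ℓ⁻¹ ^ min ((S.image x).card - 1) e ≤
      A ^ (2 * k) * ℓ⁻¹ ^ e :=
    mul_le_mul (pow_le_pow_right₀ hA1 hScard) (pow_le_pow_right₀ hinv (min_le_right _ _))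
      (by positivity) (by positivity)
  calc _ ≤ A ^ (2 * k) * ℓ⁻¹ ^ e * K' ^ (2 * k - 1) * δ * ℓ ^ e := by
        refine mul_le_mul_of_nonneg_right (hmain.trans ?_) (by positivity)
        gcongr
    _ = A ^ (2 * k) * K' ^ (2 * k - 1) * δ := by
        rw [inv_pow]; field_simp

open Classical in
-- Each of the at most `k * k` terms of the monotone transport cost is bounded separately. Between
-- the projections of `θ` and `η` there is a gap of length comparable to `‖θ - η‖`, and there the
-- difference of the distribution functions bounds the transported mass.
theorem exists_wasserstein_pow_le (q k e : ℕ) (he : e ≠ 0) {R ρ K κ : ℝ} (hR : 0 ≤ R)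
    (hρ : 0 < ρ) (hK : 0 ≤ K) (hκ : 0 < κ) :
    ∃ C : ℝ, 0 < C ∧ ∀ (θ₀ : Space q) (G H : DiscreteProb q),
      G.weights.support.card ≤ k → H.weights.support.card ≤ k →
      (∀ θ ∈ G.weights.support ∪ H.weights.support, ‖θ - θ₀‖ ≤ R) →
      ∀ u : Space q, ‖u‖ ≤ K →
      (∀ θ ∈ G.weights.support ∪ H.weights.support,
        ∀ η ∈ G.weights.support ∪ H.weights.support, κ * ‖η - θ‖ ≤ |inner ℝ u (η - θ)|) →
      (∀ T ⊆ G.weights.support ∪ H.weights.support,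
        (∀ θ ∈ T, ∀ η ∈ T, inner ℝ u (η - θ) < ρ) → T.card ≤ e + 1) →
      wasserstein e G H ^ e ≤
        C * ‖momentVec (2 * k - 1) (shift G θ₀) - momentVec (2 * k - 1) (shift H θ₀)‖ := by
  obtain ⟨C, hC, hmass⟩ := exists_abs_massLE_sub_mul_pow_le q k e hR hρ hK
  -- The projections lie in an interval of length at most `2 * (K * R)`, so dividing a gap length by
  -- `L` makes it at most `1`. `D` then bounds the distance of two atoms by `D` times the rescaled
  -- gap between them.
  set L := 2 * (K * R) + 1 with hL
  have hL1 : 1 ≤ L := by have : 0 ≤ K * R := by positivity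
                         linarith
  set D := (((2 * k : ℕ) : ℝ) + 1) * L / κ with hD
  have hD0 : 0 < D := by positivity
  -- The `+ 1` keeps the constant positive for `k = 0`.
  refine ⟨(k * k + 1) * (C * D ^ e), by positivity, ?_⟩
  intro θ₀ G H hGk hHk hS u hu hκu hclus
  replace hmass := hmass θ₀ G H hGk hHk hS u hu hclus
  set S := G.weights.support ∪ H.weights.support with hSdef
  set δ := ‖momentVec (2 * k - 1) (shift G θ₀) - momentVec (2 * k - 1) (shift H θ₀)‖ with hδdef
  have hδ : 0 ≤ δ := norm_nonneg _
  set x : Space q → ℝ := fun θ => inner ℝ u (θ - θ₀) with hx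
  have hxsub : ∀ θ η, inner ℝ u (η - θ) = x η - x θ := fun θ η => by
    rw [hx, ← inner_sub_right, sub_sub_sub_cancel_right]
  have hxR : ∀ θ ∈ S, |x θ| ≤ K * R := fun θ hθ =>
    (abs_real_inner_le_norm _ _).trans (mul_le_mul hu (hS θ hθ) (norm_nonneg _) hK)
  have hinj : Set.InjOn x S := by
    intro θ hθ η hη h
    have := hκu θ hθ η hη
    rw [hxsub, h, sub_self, abs_zero] at this
    have h0 : ‖η - θ‖ ≤ 0 := by
      by_contra hcon
      push Not at hcon
      nlinarith [mul_pos hκ hcon]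
    exact (sub_eq_zero.1 (norm_le_zero_iff.1 h0)).symm
  have hScard : (S.image x).card ≤ 2 * k :=
    Finset.card_image_le.trans ((Finset.card_union_le _ _).trans (by omega))
  obtain ⟨c, hc, hcle⟩ := exists_monotone_coupling G H x
    (hinj.mono (by simp [hSdef])) (hinj.mono (by simp [hSdef]))
  have hgapbound : ∀ a ∈ S, ∀ b ∈ S, x a < x b → ∀ m : ℝ, 0 ≤ m →
      (∀ t, x a ≤ t → t < x b → m ≤ |massLE G.weights.support G.weights x t -
          massLE H.weights.support H.weights x t|) → m * ‖b - a‖ ^ e ≤ C * D ^ e * δ := by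
    intro a ha b hb hab m hm hmt
    obtain ⟨t, ℓ, hℓ, hat, htb, hba, hgap⟩ := exists_gap hScard hab
    have hℓL : ℓ / L ≤ 1 := by
      rw [div_le_one (by linarith)]
      have h1 := (abs_le.1 (hxR a ha)).1
      have h2 := (abs_le.1 (hxR b hb)).2
      linarith
    have hle : ℓ / L ≤ ℓ := div_le_self hℓ.le hL1
    have h1 := hmass t (ℓ / L) (by positivity) hℓL fun θ hθ hθt => by
      have := hgap (x θ) (Finset.mem_image_of_mem x hθ) hθt
      change t + ℓ / L ≤ x θ
      linarith
    have h2 : ‖b - a‖ ≤ D * (ℓ / L) := by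
      have h3 := hκu a ha b hb
      rw [hxsub, abs_of_pos (sub_pos.2 hab), hba] at h3
      have : D * (ℓ / L) = (((2 * k : ℕ) : ℝ) + 1) * ℓ / κ := by
        rw [hD]; field_simp
      rw [this, le_div_iff₀ hκ]
      linarith
    calc m * ‖b - a‖ ^ e ≤ m * (D * (ℓ / L)) ^ e :=
          mul_le_mul_of_nonneg_left (pow_le_pow_left₀ (norm_nonneg _) h2 e) hm
      _ = D ^ e * (m * (ℓ / L) ^ e) := by rw [mul_pow]; ring
      _ ≤ D ^ e * (C * δ) := by
          refine mul_le_mul_of_nonneg_left (le_trans ?_ h1) (by positivity)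
          exact mul_le_mul_of_nonneg_right (hmt t hat (by linarith)) (by positivity)
      _ = C * D ^ e * δ := by ring
  have hterm : ∀ θ ∈ G.weights.support, ∀ η ∈ H.weights.support,
      c θ η * ‖θ - η‖ ^ e ≤ C * D ^ e * δ := by
    intro θ hθ η hη
    have hθS : θ ∈ S := Finset.mem_union_left _ hθ
    have hηS : η ∈ S := Finset.mem_union_right _ hη
    rcases lt_trichotomy (x θ) (x η) with h | h | h
    · rw [norm_sub_rev]
      exact hgapbound θ hθS η hηS h _ (hc.1 θ hθ η hη) fun t h1 h2 => hcle θ η t (Or.inl ⟨h1, h2⟩)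
    · rw [hinj hθS hηS h, sub_self, norm_zero, zero_pow he, mul_zero]
      positivity
    · exact hgapbound η hηS θ hθS h _ (hc.1 θ hθ η hη) fun t h1 h2 =>
        hcle θ η t (Or.inr ⟨h1, h2⟩)
  refine (wasserstein_pow_le_of_isCoupling he hc).trans ?_
  have hB : 0 ≤ C * D ^ e * δ := by positivity
  calc _ ≤ ∑ θ ∈ G.weights.support, ∑ η ∈ H.weights.support, C * D ^ e * δ :=
        Finset.sum_le_sum fun θ hθ => Finset.sum_le_sum fun η hη => hterm θ hθ η hη
    _ = (G.weights.support.card : ℝ) * H.weights.support.card * (C * D ^ e * δ) := by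
        simp only [Finset.sum_const, nsmul_eq_mul]; ring
    _ ≤ (k * k + 1) * (C * D ^ e * δ) := by
        refine mul_le_mul_of_nonneg_right ?_ hB
        have h1 : (G.weights.support.card : ℝ) ≤ k := by exact_mod_cast hGk
        have h2 : (H.weights.support.card : ℝ) ≤ k := by exact_mod_cast hHk
        have := mul_le_mul h1 h2 (Nat.cast_nonneg _) (Nat.cast_nonneg _)
        linarith
    _ = _ := by ring

/-! ### The global bound: distinguishability and the infimum -/

open Classical in
-- The vectors to separate are the at most `N * N` differences; `κ` and `K` depend on their number
-- only, not on their position.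
theorem exists_direction_of_card_le (q N : ℕ) : ∃ κ K : ℝ, 0 < κ ∧ 0 ≤ K ∧
    ∀ S : Finset (Space q), S.card ≤ N → ∃ u : Space q, ‖u‖ ≤ K ∧
      ∀ θ ∈ S, ∀ η ∈ S, κ * ‖η - θ‖ ≤ |inner ℝ u (η - θ)| := by
  obtain ⟨κ, hκ, -, h⟩ := exists_separating_direction (E := Space q) (N * N)
  refine ⟨κ, (N * N : ℕ), hκ, Nat.cast_nonneg _, fun S hS => ?_⟩
  obtain ⟨u, hu, hT⟩ := h ((S ×ˢ S).image fun P => P.2 - P.1)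
    (Finset.card_image_le.trans (by rw [Finset.card_product]; exact Nat.mul_le_mul hS hS))
  exact ⟨u, hu, fun θ hθ η hη =>
    hT _ (Finset.mem_image.2 ⟨(θ, η), Finset.mem_product.2 ⟨hθ, hη⟩, rfl⟩)⟩

open Classical in
-- For `e = 2k - 1` a cluster of at most `e + 1 = 2k` atoms is no restriction, so any `ρ` would do.
theorem exists_wasserstein_pow_le_global (q k : ℕ) (hk : 1 ≤ k) {R : ℝ} (hR : 0 ≤ R) :
    ∃ C : ℝ, 0 < C ∧ ∀ (θ₀ : Space q) (G H : DiscreteProb q),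
      G.weights.support.card ≤ k → H.weights.support.card ≤ k →
      (∀ θ ∈ G.weights.support ∪ H.weights.support, ‖θ - θ₀‖ ≤ R) →
      wasserstein (2 * k - 1) G H ^ (2 * k - 1) ≤
        C * ‖momentVec (2 * k - 1) (shift G θ₀) - momentVec (2 * k - 1) (shift H θ₀)‖ := by
  obtain ⟨κ, K, hκ, hK, hdir⟩ := exists_direction_of_card_le q (2 * k)
  obtain ⟨C, hC, h⟩ :=
    exists_wasserstein_pow_le q k (2 * k - 1) (by omega) hR one_pos hK hκ
  refine ⟨C, hC, fun θ₀ G H hG hH hS => ?_⟩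
  have hcard : (G.weights.support ∪ H.weights.support).card ≤ 2 * k :=
    (Finset.card_union_le _ _).trans (by omega)
  obtain ⟨u, hu, hsep⟩ := hdir _ hcard
  exact h θ₀ G H hG hH hS u hu hsep fun T hT _ =>
    (Finset.card_le_card hT).trans (hcard.trans (by omega))

theorem isDistinguishable_monomialFamily {q k : ℕ} (hk : 1 ≤ k) (Θ : Set (Space q))
    (θ₀ : Space q) : IsDistinguishable k Θ (monomialFamily (2 * k - 1) θ₀) := by
  classical
  intro G hG H hH hGH
  -- Compactness is not available here; the sum of the norms serves as a radius for these two
  -- distributions.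
  obtain ⟨C, hC, h⟩ := exists_wasserstein_pow_le_global q k hk
    (R := ∑ θ ∈ G.weights.support ∪ H.weights.support, ‖θ - θ₀‖)
    (Finset.sum_nonneg fun _ _ => norm_nonneg _)
  have hle := h θ₀ G H hG.2 hH.2 fun θ hθ =>
    Finset.single_le_sum (f := fun θ => ‖θ - θ₀‖) (fun _ _ => norm_nonneg _) hθ
  have hpos := (wasserstein_pow_pos (p := 2 * k - 1) (by omega) hGH).trans_le hle
  have hne : momentVec (2 * k - 1) (shift G θ₀) - momentVec (2 * k - 1) (shift H θ₀) ≠ 0 := by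
    intro h0
    rw [h0, norm_zero, mul_zero] at hpos
    exact hpos.false
  obtain ⟨⟨α, hα⟩, hne⟩ := Function.ne_iff.1 hne
  have hne' : expect G (fun θ => monomial α (θ - θ₀)) -
      expect H (fun θ => monomial α (θ - θ₀)) ≠ 0 := by
    simpa [momentVec, expect_shift] using hne
  refine lt_of_lt_of_le (EReal.coe_pos.2 (abs_pos.2 hne')) ?_
  exact le_iSup₂ (f := fun (φ : Space q → ℝ) (_ : φ ∈ monomialFamily (2 * k - 1) θ₀) =>
    ((|expect G φ - expect H φ| : ℝ) : EReal)) _ ⟨α, hα, rfl⟩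

/-- Division by zero yields `0`, so the passage to the quotient needs the positivity of the
Wasserstein distance. -/
theorem inv_le_moment_ratio {q n p : ℕ} (hp : p ≠ 0) {G H : DiscreteProb q} (hGH : G ≠ H)
    {θ₀ : Space q} {C : ℝ} (hC : 0 < C)
    (h : wasserstein p G H ^ p ≤ C * ‖momentVec n (shift G θ₀) - momentVec n (shift H θ₀)‖) :
    ((C⁻¹ : ℝ) : EReal) ≤ ((‖momentVec n (shift G θ₀) - momentVec n (shift H θ₀)‖ /
      wasserstein p G H ^ p : ℝ) : EReal) := by
  rw [EReal.coe_le_coe_iff, le_div_iff₀ (wasserstein_pow_pos hp hGH), inv_mul_le_iff₀ hC]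
  exact h

theorem exists_norm_sub_le {q : ℕ} {Θ : Set (Space q)} (hΘ : IsCompact Θ) (θ₀ : Space q) :
    ∃ R : ℝ, 0 ≤ R ∧ ∀ θ ∈ Θ, ‖θ - θ₀‖ ≤ R := by
  obtain ⟨R, hR⟩ := hΘ.isBounded.subset_closedBall θ₀
  refine ⟨max R 0, le_max_right _ _, fun θ hθ => le_trans ?_ (le_max_left _ _)⟩
  have := hR hθ
  rwa [Metric.mem_closedBall, dist_eq_norm] at this

theorem iInf_moment_ratio_pos {q k : ℕ} (hk : 1 ≤ k) {Θ : Set (Space q)} (θ₀ : Space q)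
    (hΘ : IsCompact Θ) :
    (0 : EReal) < ⨅ (G ∈ atMostAtoms k Θ) (H ∈ atMostAtoms k Θ) (_ : G ≠ H),
        ((‖momentVec (2 * k - 1) (shift G θ₀) - momentVec (2 * k - 1) (shift H θ₀)‖ /
          wasserstein (2 * k - 1) G H ^ (2 * k - 1) : ℝ) : EReal) := by
  classical
  obtain ⟨R, hR, hΘR⟩ := exists_norm_sub_le hΘ θ₀
  obtain ⟨C, hC, h⟩ := exists_wasserstein_pow_le_global q k hk hR
  refine lt_of_lt_of_le (EReal.coe_pos.2 (inv_pos.2 hC)) ?_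
  refine le_iInf₂ fun G hG => le_iInf₂ fun H hH => le_iInf fun hGH => ?_
  refine inv_le_moment_ratio (by omega) hGH hC (h θ₀ G H hG.2 hH.2 fun θ hθ => hΘR θ ?_)
  exact (Finset.mem_union.1 hθ).elim (fun h => hG.1 h) fun h => hH.1 h

/-! ### The local bound near a distribution with `k₀` atoms -/

theorem wasserstein_comm {q : ℕ} (p : ℕ) (G H : DiscreteProb q) :
    wasserstein p G H = wasserstein p H G := by
  have key : ∀ G H : DiscreteProb q, {t : ℝ | ∃ c : Space q → Space q → ℝ, IsCoupling G H c ∧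
      t = ∑ θ ∈ G.weights.support, ∑ η ∈ H.weights.support, c θ η * ‖θ - η‖ ^ p} ⊆
      {t : ℝ | ∃ c : Space q → Space q → ℝ, IsCoupling H G c ∧
      t = ∑ θ ∈ H.weights.support, ∑ η ∈ G.weights.support, c θ η * ‖θ - η‖ ^ p} := by
    rintro G H t ⟨c, ⟨h1, h2, h3⟩, rfl⟩
    refine ⟨fun θ η => c η θ, ⟨fun θ hθ η hη => h1 η hη θ hθ, h3, h2⟩, ?_⟩
    rw [Finset.sum_comm]
    simp only [norm_sub_rev]
  rw [wasserstein, wasserstein, (key G H).antisymm (key H G)]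

/-- Otherwise the whole mass of `y` would have to travel at least `r`. -/
theorem exists_near_atom {q : ℕ} {G G₀ : DiscreteProb q} {r : ℝ} (hr : 0 < r) {y : Space q}
    (hy : y ∈ G₀.weights.support) (hW : wasserstein 1 G G₀ < G₀.weights y * r) :
    ∃ g ∈ G.weights.support, ‖g - y‖ < r := by
  by_contra hcon
  push Not at hcon
  have hyG : G.weights y = 0 := by
    by_contra hne
    have := hcon y (Finsupp.mem_support_iff.2 hne)
    rw [sub_self, norm_zero] at this
    linarith
  have := mul_pow_le_wasserstein_pow one_ne_zero (H := G) hy hr.le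
    fun η hη _ => by rw [norm_sub_rev]; exact hcon η hη
  rw [hyG, pow_one, pow_one, sub_zero, wasserstein_comm] at this
  linarith

/-- Here `A` is the set of atoms of a distribution near `G₀`, `Y` that of `G₀`, `g y` an atom close
to `y`, and `T` a cluster. At most one `g y` lies in `T`, so the other `Y.card - 1` are atoms spent
outside the cluster. -/
theorem card_inter_add_card_le {E : Type*} [DecidableEq E] {A Y T : Finset E} {g : E → E}
    (hgA : ∀ y ∈ Y, g y ∈ A) (hginj : Set.InjOn g Y)
    (hgT : ∀ y ∈ Y, ∀ z ∈ Y, g y ∈ T → g z ∈ T → y = z) :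
    (A ∩ T).card + Y.card ≤ A.card + 1 := by
  have h1 : (Y.filter fun y => g y ∈ T).card ≤ 1 := by
    refine Finset.card_le_one.2 fun y hy z hz => ?_
    rw [Finset.mem_filter] at hy hz
    exact hgT y hy.1 z hz.1 hy.2 hz.2
  have h2 : (Y.filter fun y => ¬ g y ∈ T).card ≤ (A \ T).card := by
    refine Finset.card_le_card_of_injOn g (fun y hy => ?_)
      (hginj.mono (Finset.coe_subset.2 (Finset.filter_subset _ _)))
    have hy' := Finset.mem_filter.1 hy
    exact Finset.mem_sdiff.2 ⟨hgA y hy'.1, hy'.2⟩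
  have h3 := Finset.card_filter_add_card_filter_not (s := Y) (fun y => g y ∈ T)
  have h4 := Finset.card_inter_add_card_sdiff A T
  omega

theorem exists_pos_le_of_finset {ι : Type*} (s : Finset ι) (f : ι → ℝ) (hf : ∀ i ∈ s, 0 < f i) :
    ∃ m : ℝ, 0 < m ∧ ∀ i ∈ s, m ≤ f i := by
  rcases s.eq_empty_or_nonempty with rfl | hs
  · exact ⟨1, one_pos, by simp⟩
  · obtain ⟨i, hi, hmin⟩ := s.exists_min_image f hs
    exact ⟨f i, hf i hi, hmin⟩

/-- Atoms close to different atoms of `G₀` have projections at least `κ * m / 2` apart. A cluster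
therefore takes at most `k - k₀ + 1` atoms from each of `G` and `H`, in all `e + 1` for `e = 2 * (k
- k₀ + 1) - 1`. For this the direction has to separate the atoms of `G₀` as well, hence `3 * k`
points. -/
theorem exists_wasserstein_pow_le_local {q k k₀ : ℕ} (hk₀k : k₀ ≤ k)
    {G₀ : DiscreteProb q} (hG₀ : G₀.weights.support.card = k₀) {R : ℝ} (hR : 0 ≤ R) :
    ∃ C ε : ℝ, 0 < C ∧ 0 < ε ∧ ∀ (θ₀ : Space q) (G H : DiscreteProb q),
      G.weights.support.card ≤ k → H.weights.support.card ≤ k →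
      (∀ θ ∈ G.weights.support, ‖θ - θ₀‖ ≤ R) → (∀ θ ∈ H.weights.support, ‖θ - θ₀‖ ≤ R) →
      wasserstein 1 G G₀ < ε → wasserstein 1 H G₀ < ε →
      wasserstein (2 * (k - k₀ + 1) - 1) G H ^ (2 * (k - k₀ + 1) - 1) ≤
        C * ‖momentVec (2 * k - 1) (shift G θ₀) - momentVec (2 * k - 1) (shift H θ₀)‖ := by
  classical
  set Y := G₀.weights.support with hY
  obtain ⟨κ, K, hκ, hK, hdir⟩ := exists_direction_of_card_le q (3 * k)
  obtain ⟨m, hm, hmY⟩ := exists_pos_le_of_finset Y.offDiag (fun P => ‖P.2 - P.1‖)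
    fun P hP => norm_pos_iff.2 (sub_ne_zero.2 (Finset.mem_offDiag.1 hP).2.2.symm)
  obtain ⟨w, hw, hwY⟩ := exists_pos_le_of_finset Y (fun y => G₀.weights y)
    fun y hy => (G₀.nonneg y).lt_of_ne (Finsupp.mem_support_iff.1 hy).symm
  -- Moving two atoms of `G₀` by less than `r` changes the difference of their projections by at
  -- most `2 * K * r ≤ κ * m / 2`, half of the separation `κ * m`. The summand `1` covers `K = 0`.
  set r := κ * m / (4 * (K + 1)) with hr
  have hr0 : 0 < r := by positivity
  have hKr : K * r + K * r ≤ κ * m / 2 := by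
    have : r * (4 * (K + 1)) = κ * m := by rw [hr]; field_simp
    nlinarith
  have hρ : 0 < κ * m / 2 := by positivity
  obtain ⟨C, hC, h⟩ :=
    exists_wasserstein_pow_le q k (2 * (k - k₀ + 1) - 1) (by omega) hR hρ hK hκ
  refine ⟨C, w * r, hC, by positivity, fun θ₀ G H hG hH hGR hHR hWG hWH => ?_⟩
  obtain ⟨u, hu, hsep⟩ := hdir (G.weights.support ∪ H.weights.support ∪ Y) (by
    have h1 := Finset.card_union_le (G.weights.support ∪ H.weights.support) Y
    have h2 := Finset.card_union_le G.weights.support H.weights.support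
    omega)
  refine h θ₀ G H hG hH (fun θ hθ => (Finset.mem_union.1 hθ).elim (hGR θ) (hHR θ)) u hu
    (fun θ hθ η hη => hsep θ (Finset.mem_union_left _ hθ) η (Finset.mem_union_left _ hη)) ?_
  intro T hT hTρ
  have hinter : ∀ F : DiscreteProb q, wasserstein 1 F G₀ < w * r →
      (F.weights.support ∩ T).card + Y.card ≤ F.weights.support.card + 1 := by
    intro F hWF
    have hnear : ∀ y ∈ Y, ∃ g ∈ F.weights.support, ‖g - y‖ < r := fun y hy =>
      exists_near_atom hr0 hy (hWF.trans_le (mul_le_mul_of_nonneg_right (hwY y hy) hr0.le))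
    choose! g hgF hgr using hnear
    have hfar : ∀ y ∈ Y, ∀ z ∈ Y, y ≠ z → κ * m / 2 ≤ |inner ℝ u (g z - g y)| := by
      intro y hy z hz hyz
      have h1 := hsep y (Finset.mem_union_right _ hy) z (Finset.mem_union_right _ hz)
      have h2 : m ≤ ‖z - y‖ := hmY (y, z) (Finset.mem_offDiag.2 ⟨hy, hz, hyz⟩)
      have h3 : ∀ y ∈ Y, |inner ℝ u (g y - y)| ≤ K * r := fun y hy =>
        (abs_real_inner_le_norm _ _).trans (mul_le_mul hu (hgr y hy).le (norm_nonneg _) hK)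
      have h4 : inner ℝ u (z - y) = inner ℝ u (g z - g y) - inner ℝ u (g z - z) +
          inner ℝ u (g y - y) := by
        simp only [inner_sub_right]; ring
      have h5 := abs_add_le (inner ℝ u (g z - g y) - inner ℝ u (g z - z)) (inner ℝ u (g y - y))
      have h6 := abs_sub (inner ℝ u (g z - g y)) (inner ℝ u (g z - z))
      rw [← h4] at h5
      have h7 := mul_le_mul_of_nonneg_left h2 hκ.le
      linarith [h3 y hy, h3 z hz]
    refine card_inter_add_card_le (g := g) hgF ?_ ?_
    · intro y hy z hz hyz
      by_contra hne
      have := hfar y hy z hz hne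
      rw [hyz, sub_self, inner_zero_right, abs_zero] at this
      linarith
    · intro y hy z hz hyT hzT
      by_contra hne
      refine (hfar y hy z hz hne).not_gt (abs_lt.2 ⟨?_, hTρ _ hyT _ hzT⟩)
      have := hTρ _ hzT _ hyT
      rw [← neg_sub, inner_neg_right] at this
      linarith
  have h1 := hinter G hWG
  have h2 := hinter H hWH
  have h3 : T = G.weights.support ∩ T ∪ H.weights.support ∩ T := by
    rw [← Finset.union_inter_distrib_right, Finset.inter_eq_right.2 hT]
  have h4 := Finset.card_union_le (G.weights.support ∩ T) (H.weights.support ∩ T)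
  rw [← h3] at h4
  omega

theorem liminf_moment_ratio_pos {q k k₀ : ℕ} (hk₀k : k₀ ≤ k) {Θ : Set (Space q)}
    (θ₀ : Space q) (hΘ : IsCompact Θ) {G₀ : DiscreteProb q} (hG₀ : G₀ ∈ exactAtoms k₀ Θ) :
    (0 : EReal) < liminf
      (fun P : DiscreteProb q × DiscreteProb q =>
        ((‖momentVec (2 * k - 1) (shift P.1 θ₀) - momentVec (2 * k - 1) (shift P.2 θ₀)‖ /
          wasserstein (2 * (k - k₀ + 1) - 1) P.1 P.2 ^ (2 * (k - k₀ + 1) - 1) : ℝ) : EReal))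
      (pairsNear k Θ G₀) := by
  obtain ⟨R, hR, hΘR⟩ := exists_norm_sub_le hΘ θ₀
  obtain ⟨C, ε, hC, hε, h⟩ := exists_wasserstein_pow_le_local hk₀k hG₀.2 hR
  refine lt_of_lt_of_le (EReal.coe_pos.2 (inv_pos.2 hC)) (le_liminf_of_le (by isBoundedDefault) ?_)
  have hnhds : {G : DiscreteProb q | wasserstein 1 G G₀ < ε} ∈ w1Nhds G₀ :=
    preimage_mem_comap (Iio_mem_nhds hε)
  filter_upwards [mem_inf_of_left (prod_mem_prod hnhds hnhds),
    mem_inf_of_right (mem_principal_self _)] with P hP hPk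
  exact inv_le_moment_ratio (by omega) hPk.2.2 hC (h θ₀ P.1 P.2 hPk.1.2 hPk.2.1.2
    (fun θ hθ => hΘR θ (hPk.1.1 hθ)) (fun θ hθ => hΘR θ (hPk.2.1.1 hθ)) hP.1 hP.2)

/-! ### Hermite interpolation and linear independence -/

/-- The values of a polynomial and its derivatives at distinct points, `M i` of them at the
`i`-th point, are linearly independent functionals on polynomials of degree `< ∑ M i`. -/
theorem hermite_linearIndependent {ι : Type*} [Fintype ι] {M : ι → ℕ} {t : ι → ℝ}
    (ht : Function.Injective t) {b : ι → ℕ → ℝ}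
    (h : ∀ P : Polynomial ℝ, P.natDegree + 1 ≤ ∑ i, M i →
      ∑ i, ∑ m ∈ Finset.range (M i), b i m * (Polynomial.derivative^[m] P).eval (t i) = 0)
    (i : ι) {m : ℕ} (hm : m < M i) : b i m = 0 := by
  classical
  by_contra hbm
  have hne : ((Finset.range (M i)).filter fun m => b i m ≠ 0).Nonempty :=
    ⟨m, Finset.mem_filter.2 ⟨Finset.mem_range.2 hm, hbm⟩⟩
  obtain ⟨n, hn, hmax⟩ := Finset.exists_max_image _ id hne
  obtain ⟨hnM, hbn⟩ := Finset.mem_filter.1 hn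
  rw [Finset.mem_range] at hnM
  -- With `n` the largest order at `t i` with a nonzero coefficient, `(X - t i) ^ n * Q` isolates
  -- it: `Q` kills all functionals at the other points, the power kills the lower orders at `t i`,
  -- and higher orders have coefficient zero.
  set Q : Polynomial ℝ := ∏ j ∈ Finset.univ.erase i, (Polynomial.X - Polynomial.C (t j)) ^ M j
  set P : Polynomial ℝ := (Polynomial.X - Polynomial.C (t i)) ^ n * Q with hP
  have hQi : Q.eval (t i) ≠ 0 := by
    rw [Polynomial.eval_prod, Finset.prod_ne_zero_iff]
    intro j hj
    simp only [Polynomial.eval_pow, Polynomial.eval_sub, Polynomial.eval_X, Polynomial.eval_C]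
    exact pow_ne_zero _ (sub_ne_zero.2 fun h => Finset.ne_of_mem_erase hj (ht h).symm)
  have hP0 : P ≠ 0 := by
    refine mul_ne_zero (pow_ne_zero _ (Polynomial.X_sub_C_ne_zero _)) ?_
    intro h0
    rw [h0, Polynomial.eval_zero] at hQi
    exact hQi rfl
  have hdeg : P.natDegree + 1 ≤ ∑ i, M i := by
    have h1 : P.natDegree ≤ n + ∑ j ∈ Finset.univ.erase i, M j := by
      refine Polynomial.natDegree_mul_le.trans (Nat.add_le_add ?_ ?_)
      · rw [Polynomial.natDegree_pow, Polynomial.natDegree_X_sub_C, mul_one]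
      · refine (Polynomial.natDegree_prod_le _ _).trans (Finset.sum_le_sum fun j _ => ?_)
        rw [Polynomial.natDegree_pow, Polynomial.natDegree_X_sub_C, mul_one]
    rw [← Finset.add_sum_erase _ _ (Finset.mem_univ i)]
    omega
  have hvan : ∀ j m' N, (Polynomial.X - Polynomial.C (t j)) ^ N ∣ P → m' < N →
      (Polynomial.derivative^[m'] P).eval (t j) = 0 := fun j m' N hd hm' =>
    Polynomial.isRoot_iterate_derivative_of_lt_rootMultiplicity
      (hm'.trans_le ((Polynomial.le_rootMultiplicity_iff hP0).2 hd))
  have hder : (Polynomial.derivative^[n] P).eval (t i) ≠ 0 := by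
    intro h0
    have hlt : n < P.rootMultiplicity (t i) := by
      refine Polynomial.lt_rootMultiplicity_of_isRoot_iterate_derivative hP0 fun m' hm' => ?_
      rcases hm'.lt_or_eq with hlt | rfl
      · exact hvan i m' n (dvd_mul_right _ _) hlt
      · exact h0
    have hdvd := (Polynomial.le_rootMultiplicity_iff hP0).1 (Nat.succ_le_of_lt hlt)
    rw [pow_succ, hP, mul_dvd_mul_iff_left (pow_ne_zero _ (Polynomial.X_sub_C_ne_zero _)),
      Polynomial.dvd_iff_isRoot] at hdvd
    exact hQi hdvd
  have hsum := h P hdeg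
  rw [Finset.sum_eq_single i, Finset.sum_eq_single n] at hsum
  · exact (mul_ne_zero hbn hder) hsum
  · intro m' hm' hne'
    rcases lt_or_gt_of_ne hne' with hlt | hgt
    · rw [hvan i m' n (dvd_mul_right _ _) hlt, mul_zero]
    · have : b i m' = 0 := by
        by_contra hb
        exact absurd (hmax m' (Finset.mem_filter.2 ⟨hm', hb⟩)) (not_le.2 hgt)
      rw [this, zero_mul]
  · intro hn'
    exact absurd (Finset.mem_range.2 hnM) hn'
  · intro j _ hji
    refine Finset.sum_eq_zero fun m' hm' => ?_
    rw [hvan j m' (M j) (dvd_mul_of_dvd_right (Finset.dvd_prod_of_mem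
      (fun j => (Polynomial.X - Polynomial.C (t j)) ^ M j)
      (Finset.mem_erase.2 ⟨hji, Finset.mem_univ j⟩)) _)
      (Finset.mem_range.1 hm'), mul_zero]
  · intro hi
    exact absurd (Finset.mem_univ i) hi

theorem partialD_const_mul_polynomial {q : ℕ} (i : Fin q) (u θ₀ : Space q) (c : ℝ)
    (P : Polynomial ℝ) :
    partialD i (fun θ => c * P.eval (inner ℝ u (θ - θ₀))) =
      fun θ => (c * u i) * (Polynomial.derivative P).eval (inner ℝ u (θ - θ₀)) := by
  funext θ
  have h1 : HasFDerivAt (fun θ : Space q => inner ℝ u (θ - θ₀)) (innerSL ℝ u) θ :=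
    (innerSL ℝ u).hasFDerivAt.comp θ ((hasFDerivAt_id θ).sub_const θ₀)
  have h2 := ((P.hasDerivAt (inner ℝ u (θ - θ₀))).comp_hasFDerivAt θ h1).const_mul c
  have h3 : fderiv ℝ (fun θ => c * P.eval (inner ℝ u (θ - θ₀))) θ = _ := h2.fderiv
  rw [partialD, h3]
  simp [EuclideanSpace.inner_single_right]
  ring

theorem partialD_iterate_const_mul_polynomial {q : ℕ} (i : Fin q) (u θ₀ : Space q) (n : ℕ)
    (c : ℝ) (P : Polynomial ℝ) :
    (partialD i)^[n] (fun θ => c * P.eval (inner ℝ u (θ - θ₀))) =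
      fun θ => (c * u i ^ n) * (Polynomial.derivative^[n] P).eval (inner ℝ u (θ - θ₀)) := by
  induction n with
  | zero => simp
  | succ n ih =>
    rw [Function.iterate_succ_apply', ih, partialD_const_mul_polynomial,
      Function.iterate_succ_apply', pow_succ, mul_assoc]

/-- On functions of `⟨u, θ - θ₀⟩` the operator `D^α` depends on `α` only through its order and the
weight `u^α`, which reduces the problem to one variable. -/
theorem multiD_polynomial {q : ℕ} (α : Fin q → ℕ) (u θ₀ : Space q) (P : Polynomial ℝ) :
    multiD α (fun θ => P.eval (inner ℝ u (θ - θ₀))) =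
      fun θ => monomial α u *
        (Polynomial.derivative^[∑ i, α i] P).eval (inner ℝ u (θ - θ₀)) := by
  have key : ∀ l : List (Fin q),
      l.foldr (fun i g => (partialD i)^[α i] g) (fun θ => P.eval (inner ℝ u (θ - θ₀))) =
      fun θ => (l.map fun i => u i ^ α i).prod *
        (Polynomial.derivative^[(l.map α).sum] P).eval (inner ℝ u (θ - θ₀)) := by
    intro l
    induction l with
    | nil => simp
    | cons i l ih =>
      rw [List.foldr_cons, ih, partialD_iterate_const_mul_polynomial, List.map_cons,
        List.prod_cons, List.map_cons, List.sum_cons, Function.iterate_add_apply,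
        mul_comm (u i ^ α i)]
  rw [multiD, key, monomial, Fin.prod_univ_def, Fin.sum_univ_def]

theorem contDiff_partialD {q : ℕ} (i : Fin q) {f : Space q → ℝ} (hf : ContDiff ℝ ∞ f) :
    ContDiff ℝ ∞ (partialD i f) :=
  (hf.fderiv_right (by simp)).clm_apply contDiff_const

theorem contDiff_partialD_iterate {q : ℕ} (i : Fin q) (n : ℕ) {f : Space q → ℝ}
    (hf : ContDiff ℝ ∞ f) : ContDiff ℝ ∞ ((partialD i)^[n] f) := by
  induction n with
  | zero => exact hf
  | succ n ih => rw [Function.iterate_succ_apply']; exact contDiff_partialD i ih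

theorem partialD_sum {q : ℕ} (i : Fin q) {ι : Type*} (s : Finset ι) (c : ι → ℝ)
    {f : ι → Space q → ℝ} (hf : ∀ j, ContDiff ℝ ∞ (f j)) :
    partialD i (fun θ => ∑ j ∈ s, c j * f j θ) = fun θ => ∑ j ∈ s, c j * partialD i (f j) θ := by
  funext θ
  have hd : ∀ j, DifferentiableAt ℝ (f j) θ := fun j => (hf j).differentiable (by simp) θ
  rw [partialD, fderiv_fun_sum fun j _ => (hd j).const_mul (c j)]
  simp only [sum_apply]
  refine Finset.sum_congr rfl fun j _ => ?_
  rw [fderiv_const_mul (hd j)]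
  rfl

theorem partialD_iterate_sum {q : ℕ} (i : Fin q) (n : ℕ) {ι : Type*} (s : Finset ι) (c : ι → ℝ)
    {f : ι → Space q → ℝ} (hf : ∀ j, ContDiff ℝ ∞ (f j)) :
    (partialD i)^[n] (fun θ => ∑ j ∈ s, c j * f j θ) =
      fun θ => ∑ j ∈ s, c j * (partialD i)^[n] (f j) θ := by
  induction n with
  | zero => rfl
  | succ n ih =>
    rw [Function.iterate_succ_apply', ih,
      partialD_sum i s c fun j => contDiff_partialD_iterate i n (hf j)]
    simp only [Function.iterate_succ_apply']

theorem multiD_sum {q : ℕ} (α : Fin q → ℕ) {ι : Type*} (s : Finset ι) (c : ι → ℝ)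
    {f : ι → Space q → ℝ} (hf : ∀ j, ContDiff ℝ ∞ (f j)) :
    multiD α (fun θ => ∑ j ∈ s, c j * f j θ) = fun θ => ∑ j ∈ s, c j * multiD α (f j) θ := by
  have key : ∀ l : List (Fin q),
      (∀ j, ContDiff ℝ ∞ (l.foldr (fun i g => (partialD i)^[α i] g) (f j))) ∧
      l.foldr (fun i g => (partialD i)^[α i] g) (fun θ => ∑ j ∈ s, c j * f j θ) =
      fun θ => ∑ j ∈ s, c j * l.foldr (fun i g => (partialD i)^[α i] g) (f j) θ := by
    intro l
    induction l with
    | nil => exact ⟨hf, rfl⟩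
    | cons i l ih =>
      refine ⟨fun j => contDiff_partialD_iterate i _ (ih.1 j), ?_⟩
      rw [List.foldr_cons, ih.2, partialD_iterate_sum i _ s c ih.1]
      rfl
  exact (key _).2

theorem contDiff_monomial_sub {q : ℕ} {n : WithTop ℕ∞} (α : Fin q → ℕ) (θ₀ : Space q) :
    ContDiff ℝ n fun θ => monomial α (θ - θ₀) := by
  unfold monomial
  refine contDiff_prod fun i _ => ContDiff.pow ?_ _
  exact (EuclideanSpace.proj (𝕜 := ℝ) i).contDiff.comp (contDiff_id.sub contDiff_const)

/-- The relation is linear in the test function, and by the multinomial theorem these test functions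
lie in the span of the family. -/
theorem sum_multiD_polynomial_eq_zero {q n : ℕ} {ι : Type*} [Fintype ι] {θ₀ : Space q}
    {A : ι → Finset (Fin q → ℕ)} {a : ι → (Fin q → ℕ) → ℝ} {θ : ι → Space q}
    (h : ∀ φ ∈ monomialFamily n θ₀, ∑ i, ∑ α ∈ A i, a i α * multiD α φ (θ i) = 0)
    (u : Space q) {P : Polynomial ℝ} (hP : P.natDegree ≤ n) :
    ∑ i, ∑ α ∈ A i, a i α * multiD α (fun θ => P.eval (inner ℝ u (θ - θ₀))) (θ i) = 0 := by
  have hlin : ∀ {κ : Type} (s : Finset κ) (c : κ → ℝ) (f : κ → Space q → ℝ),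
      (∀ j, ContDiff ℝ ∞ (f j)) →
      (∀ j ∈ s, ∑ i, ∑ α ∈ A i, a i α * multiD α (f j) (θ i) = 0) →
      ∑ i, ∑ α ∈ A i, a i α * multiD α (fun θ => ∑ j ∈ s, c j * f j θ) (θ i) = 0 := by
    intro κ s c f hf hs
    have : ∑ i, ∑ α ∈ A i, a i α * multiD α (fun θ => ∑ j ∈ s, c j * f j θ) (θ i) =
        ∑ j ∈ s, c j * ∑ i, ∑ α ∈ A i, a i α * multiD α (f j) (θ i) := by
      simp only [multiD_sum _ s c hf, Finset.mul_sum]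
      rw [Finset.sum_comm]
      refine Finset.sum_congr rfl fun i _ => ?_
      rw [Finset.sum_comm]
      refine Finset.sum_congr rfl fun α _ => Finset.sum_congr rfl fun j _ => by ring
    rw [this]
    exact Finset.sum_eq_zero fun j hj => by rw [hs j hj, mul_zero]
  simp only [Polynomial.eval_eq_sum_range]
  refine hlin _ _ _ (fun j => ?_) fun j hj => ?_
  · exact ((innerSL ℝ u).contDiff.comp (contDiff_id.sub contDiff_const)).pow j
  · simp only [inner_pow_eq_sum]
    refine hlin _ _ _ (fun α => contDiff_monomial_sub α θ₀) fun α hα => h _ ⟨α, ?_, rfl⟩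
    rw [mem_multiIndices, (Finset.mem_piAntidiag.1 hα).1]
    rw [Finset.mem_range] at hj
    omega

/-- For fixed `i` and `m`, the form `B = ∑_{|β| = m} a_{iβ} X^β` vanishes at every `u` that projects
the points to distinct reals. The exceptional `u` are the zeros of the linear forms `Lf`. -/
theorem isLinearIndependentDomain_monomialFamily {q k : ℕ} (hk : 1 ≤ k) (Θ : Set (Space q))
    (θ₀ : Space q) :
    IsLinearIndependentDomain (2 * k - 1) 1 k Θ (monomialFamily (2 * k - 1) θ₀) := by
  classical
  refine ⟨⟨Set.univ, isOpen_univ, Set.subset_univ _, ?_⟩, ?_⟩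
  · rintro φ ⟨α, -, rfl⟩
    exact (contDiff_monomial_sub α θ₀).contDiffOn
  intro ℓ _ _ M hM _ hMk θ hθ _ a
  constructor
  swap
  · intro h
    refine ⟨fun φ _ => Finset.sum_eq_zero fun i _ => Finset.sum_eq_zero fun α hα => ?_,
      Finset.sum_eq_zero fun i _ => h i 0 (mem_multiIndices.2 (by simp))⟩
    rw [h i α hα, zero_mul]
  rintro ⟨h, -⟩ i α hα
  set m := ∑ s, α s with hm
  have hMi : 1 ≤ M i := (hM i).1
  have hmM : m < M i := by rw [mem_multiIndices] at hα; omega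
  set F := (multiIndices q (M i - 1)).filter fun β => ∑ s, β s = m with hF
  set B : MvPolynomial (Fin q) ℝ :=
    ∑ β ∈ F, MvPolynomial.monomial (Finsupp.equivFunOnFinite.symm β) (a i β) with hB
  set Lf : Fin ℓ × Fin ℓ → MvPolynomial (Fin q) ℝ := fun P =>
    ∑ s, MvPolynomial.C ((θ P.1 - θ P.2) s) * MvPolynomial.X s with hLf
  have hLf0 : ∀ P ∈ (Finset.univ : Finset (Fin ℓ)).offDiag, Lf P ≠ 0 := by
    intro P hP h0
    refine (Finset.mem_offDiag.1 hP).2.2 (hθ (sub_eq_zero.1 ?_))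
    ext s
    have := congrArg (MvPolynomial.eval (Pi.single s 1)) h0
    simpa [hLf, Pi.single_apply] using this
  have hBeval : ∀ u : Space q, MvPolynomial.eval (fun s => u s) B =
      ∑ β ∈ F, a i β * monomial β u := by
    intro u
    rw [hB, map_sum]
    refine Finset.sum_congr rfl fun β _ => ?_
    rw [MvPolynomial.eval_monomial, monomial, Finsupp.prod_fintype _ _ (by simp)]
    simp
  -- The product vanishes at every point, hence is the zero polynomial over the infinite field `ℝ`;
  -- as no `Lf` is zero, `B` is.
  have hprod : B * ∏ P ∈ (Finset.univ : Finset (Fin ℓ)).offDiag, Lf P = 0 := by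
    refine MvPolynomial.funext fun v => ?_
    rw [map_mul, map_prod, map_zero]
    by_cases hv : ∏ P ∈ (Finset.univ : Finset (Fin ℓ)).offDiag, MvPolynomial.eval v (Lf P) = 0
    · rw [hv, mul_zero]
    rw [← ne_eq, Finset.prod_ne_zero_iff] at hv
    set u : Space q := WithLp.toLp 2 v with hu
    have hLu : ∀ i j, MvPolynomial.eval v (Lf (i, j)) = inner ℝ u (θ i - θ₀) -
        inner ℝ u (θ j - θ₀) := by
      intro i j
      rw [← inner_sub_right, sub_sub_sub_cancel_right, PiLp.inner_apply]
      simp [hLf, hu]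
    have hinj : Function.Injective fun j => inner ℝ u (θ j - θ₀) := by
      intro j j' hjj
      by_contra hne
      refine hv (j, j') (by simp [hne]) ?_
      rw [hLu]
      exact sub_eq_zero.2 hjj
    have hb := hermite_linearIndependent (M := M) hinj
      (b := fun i m => ∑ β ∈ multiIndices q (M i - 1) with ∑ s, β s = m, a i β * monomial β u)
      (by
        intro P hP
        -- The admissible degrees match: `P.natDegree + 1 ≤ ∑ M i ≤ 2 * k`.
        rw [← sum_multiD_polynomial_eq_zero h u (P := P) (by omega)]
        refine Finset.sum_congr rfl fun j _ => ?_
        have hMj : 1 ≤ M j := (hM j).1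
        rw [← Finset.sum_fiberwise_of_maps_to (s := multiIndices q (M j - 1))
          (t := Finset.range (M j))
          (g := fun β => ∑ s, β s) (fun β hβ => by
            rw [mem_multiIndices] at hβ
            rw [Finset.mem_range]; omega)]
        refine Finset.sum_congr rfl fun m _ => ?_
        rw [Finset.sum_mul]
        refine Finset.sum_congr rfl fun β hβ => ?_
        rw [multiD_polynomial, (Finset.mem_filter.1 hβ).2, mul_assoc])
      i hmM
    have : MvPolynomial.eval v B = 0 := (hBeval u).trans hb
    rw [this, zero_mul]
  have hB0 : B = 0 := (mul_eq_zero.1 hprod).resolve_right (Finset.prod_ne_zero_iff.2 hLf0)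
  have hcoef := congrArg (MvPolynomial.coeff (Finsupp.equivFunOnFinite.symm α)) hB0
  rw [hB, MvPolynomial.coeff_sum, MvPolynomial.coeff_zero] at hcoef
  simp only [MvPolynomial.coeff_monomial, EmbeddingLike.apply_eq_iff_eq] at hcoef
  rw [Finset.sum_ite_eq' F α, if_pos (hF ▸ Finset.mem_filter.2 ⟨hα, hm.symm⟩)] at hcoef
  exact hcoef

end FiniteMixture

end

theorem mainTheorem6 (q k : ℕ) (hk : 1 ≤ k) (Θ : Set (Space q)) (θ₀ : Space q) :
    IsLinearIndependentDomain (2 * k - 1) 1 k Θ (monomialFamily (2 * k - 1) θ₀) ∧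
    IsDistinguishable k Θ (monomialFamily (2 * k - 1) θ₀) ∧
    (IsCompact Θ →
      (∀ k₀ d₁ : ℕ, 1 ≤ k₀ → k₀ ≤ k → d₁ = k - k₀ + 1 → ∀ G₀ ∈ exactAtoms k₀ Θ,
        (0 : EReal) < liminf
          (fun P : DiscreteProb q × DiscreteProb q =>
            ((‖momentVec (2 * k - 1) (shift P.1 θ₀) - momentVec (2 * k - 1) (shift P.2 θ₀)‖ /
              wasserstein (2 * d₁ - 1) P.1 P.2 ^ (2 * d₁ - 1) : ℝ) : EReal))
          (pairsNear k Θ G₀)) ∧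
      (0 : EReal) < ⨅ (G ∈ atMostAtoms k Θ) (H ∈ atMostAtoms k Θ) (_ : G ≠ H),
        ((‖momentVec (2 * k - 1) (shift G θ₀) - momentVec (2 * k - 1) (shift H θ₀)‖ /
          wasserstein (2 * k - 1) G H ^ (2 * k - 1) : ℝ) : EReal)) := by
  refine ⟨isLinearIndependentDomain_monomialFamily hk Θ θ₀,
    isDistinguishable_monomialFamily hk Θ θ₀, fun hΘ => ⟨?_, iInf_moment_ratio_pos hk θ₀ hΘ⟩⟩
  rintro k₀ d₁ - hk₀k rfl G₀ hG₀
  exact liminf_moment_ratio_pos hk₀k θ₀ hΘ hG₀
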